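/- \textbf{Discrete-time negative imaginary lemma.} Let $G(z)$ be an $m\times m$ matrix of real rational functions that is proper. Call $G$ \emph{discrete negative imaginary} (D-NI) if (i) $G$ is analytic in $\{z\in\mathbb{C}:|z|>1\}$; (ii) $i[G(z)-G(z)^*]\ge 0$ for all $z$ with $|z|>1$ and $\operatorname{Im} z>0$; (iii) $i[G(z)-G(z)^*]=0$ for all $z$ with $|z|>1$ and $\operatorname{Im} z=0$; (iv) $i[G(z)-G(z)^*]\le 0$ for all $z$ with $|z|>1$ and $\operatorname{Im} z<0$. Here $\ge 0$ and $>0$ denote positive semidefiniteness and positive definiteness of Hermitian matrices, and $M^*$ is the conjugate transpose of $M$. Let $(A,B,C,D)$ be a minimal realization of $G$: real matrices with $G(z)=C(zI-A)^{-1}B+D$ such that the size $n$ of $A$ is the smallest possible among all such realizations of $G$. Suppose $\det(I+A)\neq 0$ and $\det(I-A)\neq 0$, and consider the condition \[ (\ast)\qquad D=D^\top,\ \text{and there is a real matrix } X=X^\top>0 \text{ with } X-A^\top XA\ge 0 \text{ and } C=-B^\top(A^\top-I)^{-1}X(A+I). \] If $G$ is D-NI, then $(\ast)$ holds. If moreover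 $G$ is symmetric, i.e. $G(z)=G(z)^\top$, then $G$ is D-NI if and only if $(\ast)$ holds. -/

import Mathlib

open scoped ComplexOrder

noncomputable section

/-- The values of a matrix of real rational functions at a complex point. Each entry is evaluated in
lowest terms (with the value `0` at a pole, where the resulting function is then not analytic). -/
def transferEval {m : ℕ} (G : Matrix (Fin m) (Fin m) (RatFunc ℝ)) (z : ℂ) :
    Matrix (Fin m) (Fin m) ℂ :=
  G.map (RatFunc.eval (algebraMap ℝ ℂ) z)

/-- Properness: in every entry the degree of the numerator is at most that of the denominator. -/
def IsProperTransfer {m : ℕ} (G : Matrix (Fin m) (Fin m) (RatFunc ℝ)) : Prop :=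
  ∀ i j, (G i j).intDegree ≤ 0

/-- Discrete negative imaginary (D-NI) functions. -/
structure IsDiscreteNegImag {m : ℕ} (G : ℂ → Matrix (Fin m) (Fin m) ℂ) : Prop where
  analytic : ∀ i j, AnalyticOnNhd ℂ (fun z => G z i j) {z : ℂ | 1 < ‖z‖}
  upper : ∀ z : ℂ, 1 < ‖z‖ → 0 < z.im →
    (Complex.I • (G z - (G z).conjTranspose)).PosSemidef
  real_axis : ∀ z : ℂ, 1 < ‖z‖ → z.im = 0 →
    Complex.I • (G z - (G z).conjTranspose) = 0
  lower : ∀ z : ℂ, 1 < ‖z‖ → z.im < 0 →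
    (-(Complex.I • (G z - (G z).conjTranspose))).PosSemidef

/-- `(A, B, C, D)` is a state-space realization of `G`, that is, `G(z) = C (z I - A)⁻¹ B + D` as an
identity of matrices of rational functions. (`z I - A` is invertible over the field of rational
functions, its determinant being the characteristic polynomial of `A`.) -/
def IsRealization {m n : ℕ} (G : Matrix (Fin m) (Fin m) (RatFunc ℝ))
    (A : Matrix (Fin n) (Fin n) ℝ) (B : Matrix (Fin n) (Fin m) ℝ)
    (C : Matrix (Fin m) (Fin n) ℝ) (D : Matrix (Fin m) (Fin m) ℝ) : Prop :=
  G = C.map RatFunc.C *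
      ((RatFunc.X : RatFunc ℝ) • (1 : Matrix (Fin n) (Fin n) (RatFunc ℝ)) - A.map RatFunc.C)⁻¹ *
      B.map RatFunc.C + D.map RatFunc.C

/-- A realization is minimal if no realization of the same transfer function has a smaller state
dimension. -/
def IsMinimalRealization {m n : ℕ} (G : Matrix (Fin m) (Fin m) (RatFunc ℝ))
    (A : Matrix (Fin n) (Fin n) ℝ) (B : Matrix (Fin n) (Fin m) ℝ)
    (C : Matrix (Fin m) (Fin n) ℝ) (D : Matrix (Fin m) (Fin m) ℝ) : Prop :=
  IsRealization G A B C D ∧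
    ∀ (k : ℕ) (A' : Matrix (Fin k) (Fin k) ℝ) (B' : Matrix (Fin k) (Fin m) ℝ)
      (C' : Matrix (Fin m) (Fin k) ℝ) (D' : Matrix (Fin m) (Fin m) ℝ),
      IsRealization G A' B' C' D' → n ≤ k

/-- The state-space conditions of the discrete-time negative imaginary lemma: `D = Dᵀ` and there is
a real `X = Xᵀ > 0` with `X - Aᵀ X A ≥ 0` and `C = -Bᵀ (Aᵀ - I)⁻¹ X (A + I)`. -/
def NegImagStateSpaceCondition {m n : ℕ}
    (A : Matrix (Fin n) (Fin n) ℝ) (B : Matrix (Fin n) (Fin m) ℝ)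
    (C : Matrix (Fin m) (Fin n) ℝ) (D : Matrix (Fin m) (Fin m) ℝ) : Prop :=
  D = D.transpose ∧
    ∃ X : Matrix (Fin n) (Fin n) ℝ, X = X.transpose ∧ X.PosDef ∧
      (X - A.transpose * X * A).PosSemidef ∧
      C = -(B.transpose * (A.transpose - 1)⁻¹ * X * (A + 1))

end

/-!
Minimality makes the poles of `G` exactly the eigenvalues of `A`, so for a D-NI function the
spectrum of `A` lies in the closed unit disc. Put `N = (1 - A)⁻¹ B`. The transform
`(z + 1) / (z - 1) * (G(1) - G(z))` is the transfer function of `(A, (1 + A) N, C, C N)`, and since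
`G(1)` is real symmetric and the multiplier is purely imaginary on the unit circle, with the sign of
`-Im z`, the D-NI property says that its Hermitian part is nonnegative there. Scaling `A` to `t A`
with `t < 1` avoids poles on the circle, so Parseval's identity and the limit `t → 1` show that this
system is passive. The least energy needed to reach a state from rest is then a quadratic storage
function; its matrix is `X`, and vanishing of the terms of the dissipation inequality linear in the
input forces `C = Nᵀ X (1 + A)`.

Conversely, the dissipation inequality for `X` gives `Im z * Im (v* G(z) v) ≤ 0` for real `v`, and
symmetry of `G` extends this to complex `v`, because the real and imaginary parts of `v` then
decouple in `v* G(z) v`.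
-/

open Matrix Polynomial Filter Topology Asymptotics

local notation "ι" => algebraMap ℝ ℂ

theorem comp_mulVec {R S m n : Type*} [NonAssocSemiring R] [NonAssocSemiring S]
    [Fintype n] (f : R →+* S) (M : Matrix m n R) (x : n → R) : f ∘ (M *ᵥ x) = M.map f *ᵥ (f ∘ x) :=
  funext (f.map_mulVec M x)

section Transfer

variable {K L : Type*} [Field K] [Field L] {m n k : Type*} [Fintype n] [DecidableEq n]
  [Fintype k] [DecidableEq k]
  {A : Matrix n n K} {B : Matrix n m K} {C : Matrix m n K} {D : Matrix m m K}

/-- The value `C (z I - A)⁻¹ B + D` at `z` of the transfer function of a state-space system; it is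
meaningful only when `z I - A` is invertible. -/
noncomputable def transferMatrix (A : Matrix n n K) (B : Matrix n m K) (C : Matrix m n K)
    (D : Matrix m m K) (z : K) : Matrix m m K :=
  C * (z • (1 : Matrix n n K) - A)⁻¹ * B + D

theorem transpose_transferMatrix (A : Matrix n n K) (B : Matrix n m K) (C : Matrix m n K)
    (D : Matrix m m K) (z : K) :
    (transferMatrix A B C D z)ᵀ = transferMatrix Aᵀ Cᵀ Bᵀ Dᵀ z := by
  simp only [transferMatrix, transpose_add, transpose_mul, transpose_nonsing_inv, transpose_sub,
    transpose_smul, transpose_one, Matrix.mul_assoc]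

theorem map_nonsing_inv (f : K →+* L) (M : Matrix n n K) : M⁻¹.map f = (M.map f)⁻¹ := by
  have hadj : M.adjugate.map f = (M.map f).adjugate := f.map_adjugate M
  have hdet : f M.det = (M.map f).det := f.map_det M
  rw [inv_def, inv_def, Ring.inverse_eq_inv', Ring.inverse_eq_inv',
    Matrix.map_smul' _ _ _ (map_mul f), map_inv₀, hadj, hdet]

theorem map_transferMatrix (f : K →+* L) (A : Matrix n n K) (B : Matrix n m K) (C : Matrix m n K)
    (D : Matrix m m K) (z : K) :
    (transferMatrix A B C D z).map f =
      transferMatrix (A.map f) (B.map f) (C.map f) (D.map f) (f z) := by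
  have hres : (z • (1 : Matrix n n K) - A).map f = f z • (1 : Matrix n n L) - A.map f := by
    rw [Matrix.map_sub f (map_sub f), Matrix.map_smul' _ _ _ (map_mul f),
      Matrix.map_one f (map_zero f) (map_one f)]
  rw [transferMatrix, transferMatrix, Matrix.map_add f (map_add f), Matrix.map_mul,
    Matrix.map_mul, map_nonsing_inv, hres]

theorem transferMatrix_intertwine {A' : Matrix k k K} {B' : Matrix k m K} {P : Matrix n k K}
    {z : K} (hA : A * P = P * A') (hz : (z • (1 : Matrix n n K) - A).det ≠ 0)
    (hz' : (z • (1 : Matrix k k K) - A').det ≠ 0) :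
    transferMatrix A (P * B') C D z = transferMatrix A' B' (C * P) D z := by
  set R := z • (1 : Matrix n n K) - A with hR
  set R' := z • (1 : Matrix k k K) - A' with hR'
  have hRP : R * P = P * R' := by
    rw [hR, hR', Matrix.sub_mul, Matrix.mul_sub, hA, smul_mul, Matrix.mul_smul, Matrix.one_mul,
      Matrix.mul_one]
  have hinv : R⁻¹ * P = P * R'⁻¹ := by
    rw [← mul_nonsing_inv_cancel_right R' (R⁻¹ * P) hz'.isUnit, Matrix.mul_assoc R⁻¹, ← hRP,
      nonsing_inv_mul_cancel_left _ _ hz.isUnit]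
  rw [transferMatrix, transferMatrix, ← hR, ← hR', Matrix.mul_assoc, ← Matrix.mul_assoc R⁻¹, hinv]
  simp only [Matrix.mul_assoc]

theorem transferMatrix_smul {t : K} (ht : t ≠ 0) (z : K) :
    transferMatrix (t • A) (t • B) C D z = transferMatrix A B C D (t⁻¹ * z) := by
  have hres : z • (1 : Matrix n n K) - t • A = t • ((t⁻¹ * z) • (1 : Matrix n n K) - A) := by
    rw [smul_sub, smul_smul, mul_inv_cancel_left₀ ht]
  have hinv : (z • (1 : Matrix n n K) - t • A)⁻¹ =
      t⁻¹ • ((t⁻¹ * z) • (1 : Matrix n n K) - A)⁻¹ := by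
    have hscalar : (t • (1 : Matrix n n K))⁻¹ = t⁻¹ • 1 :=
      inv_eq_left_inv (by rw [smul_mul_smul, inv_mul_cancel₀ ht, one_smul, Matrix.one_mul])
    rw [hres, ← smul_one_mul, Matrix.mul_inv_rev, hscalar, mul_smul_one]
  rw [transferMatrix, transferMatrix, hinv, Matrix.mul_smul, Matrix.mul_smul, Matrix.smul_mul,
    smul_inv_smul₀ ht]

/-- With `N = (1 - A)⁻¹ B`, both sides equal `(z² - 1) C (z - A)⁻¹ N`. -/
theorem transferMatrix_cayley {N : Matrix n m K} {z : K} (hN : (1 - A) * N = B)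
    (hA : (1 - A).det ≠ 0) (hz : (z • (1 : Matrix n n K) - A).det ≠ 0) :
    (z - 1) • transferMatrix A ((1 + A) * N) C (C * N) z =
      (z + 1) • (transferMatrix A B C D 1 - transferMatrix A B C D z) := by
  subst hN
  set R := z • (1 : Matrix n n K) - A with hR
  have hplus : 1 + A = (z + 1) • (1 : Matrix n n K) - R := by rw [hR]; module
  have hminus : 1 - A = R - (z - 1) • (1 : Matrix n n K) := by rw [hR]; module
  have hleft : transferMatrix A ((1 + A) * N) C (C * N) z = (z + 1) • (C * R⁻¹ * N) := by
    rw [transferMatrix, ← hR, hplus, Matrix.sub_mul, Matrix.mul_sub, smul_mul, Matrix.one_mul,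
      Matrix.mul_smul, Matrix.mul_assoc C R⁻¹ (R * N), nonsing_inv_mul_cancel_left _ _ hz.isUnit,
      sub_add_cancel]
  have hone : transferMatrix A ((1 - A) * N) C D 1 = C * N + D := by
    rw [transferMatrix, one_smul, Matrix.mul_assoc, nonsing_inv_mul_cancel_left _ _ hA.isUnit]
  have hright : transferMatrix A ((1 - A) * N) C D z = C * N - (z - 1) • (C * R⁻¹ * N) + D := by
    rw [transferMatrix, ← hR, hminus, Matrix.sub_mul, Matrix.mul_sub, smul_mul, Matrix.one_mul,
      Matrix.mul_smul, Matrix.mul_assoc C R⁻¹ (R * N), nonsing_inv_mul_cancel_left _ _ hz.isUnit]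
  rw [hleft, hone, hright]
  module

/-- The numerator of the transfer function of a state-space system over the common denominator
`A.charpoly`. -/
noncomputable def transferNum (A : Matrix n n K) (B : Matrix n m K) (C : Matrix m n K)
    (D : Matrix m m K) : Matrix m m K[X] :=
  C.map Polynomial.C * A.charmatrix.adjugate * B.map Polynomial.C + A.charpoly • D.map Polynomial.C

theorem map_charmatrix (φ : K[X] →+* L) (A : Matrix n n K) :
    A.charmatrix.map φ = φ X • (1 : Matrix n n L) - A.map (φ.comp Polynomial.C) := by
  ext i j
  by_cases h : i = j
  · subst h; simp
  · simp [h]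

theorem map_charpoly_eq_det (φ : K[X] →+* L) (A : Matrix n n K) :
    φ A.charpoly = (φ X • (1 : Matrix n n L) - A.map (φ.comp Polynomial.C)).det := by
  rw [← map_charmatrix, charpoly, φ.map_det, RingHom.mapMatrix_apply]

theorem transferMatrix_map_eq_smul_map_transferNum (φ : K[X] →+* L) (hφ : φ A.charpoly ≠ 0) :
    transferMatrix (A.map (φ.comp Polynomial.C)) (B.map (φ.comp Polynomial.C))
        (C.map (φ.comp Polynomial.C)) (D.map (φ.comp Polynomial.C)) (φ X) =
      (φ A.charpoly)⁻¹ • (transferNum A B C D).map φ := by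
  have hadj : A.charmatrix.adjugate.map φ = (A.charmatrix.map φ).adjugate :=
    φ.map_adjugate A.charmatrix
  rw [transferMatrix, transferNum, inv_def, ← map_charpoly_eq_det, ← map_charmatrix, ← hadj,
    Matrix.map_add φ (map_add φ), Matrix.map_smul' _ _ _ (map_mul φ), Matrix.map_mul,
    Matrix.map_mul, smul_add, inv_smul_smul₀ hφ, Ring.inverse_eq_inv', Matrix.mul_smul,
    Matrix.smul_mul]
  simp only [Matrix.map_map, RingHom.coe_comp]

end Transfer

section Evaluation

universe u

theorem ratFuncEval_div {K L : Type u} [Field K] [Field L] (f : K →+* L) (z : L)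
    (p : K[X]) {q : K[X]} (hq : q.eval₂ f z ≠ 0) :
    RatFunc.eval f z (algebraMap K[X] (RatFunc K) p / algebraMap K[X] (RatFunc K) q) =
      p.eval₂ f z / q.eval₂ f z := by
  have hq0 : q ≠ 0 := by rintro rfl; simp at hq
  set x := algebraMap K[X] (RatFunc K) p / algebraMap K[X] (RatFunc K) q with hx
  have hnum : x.num * q = p * x.denom := (RatFunc.num_mul_eq_mul_denom_iff hq0).mpr hx
  have hdenom : x.denom.eval₂ f z ≠ 0 := by
    obtain ⟨r, hr⟩ := RatFunc.denom_div_dvd p q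
    intro h
    exact hq (by rw [hr, eval₂_mul, ← hx, h, zero_mul])
  rw [RatFunc.eval, div_eq_div_iff hdenom hq, ← eval₂_mul, hnum, eval₂_mul]

variable {K L : Type u} [Field K] [Field L] {m n : Type*} [Fintype n] [DecidableEq n]
  {A : Matrix n n K} {B : Matrix n m K} {C : Matrix m n K} {D : Matrix m m K}

theorem det_ratFunc_resolvent_ne_zero (A : Matrix n n K) :
    ((RatFunc.X : RatFunc K) • (1 : Matrix n n (RatFunc K)) - A.map RatFunc.C).det ≠ 0 := by
  have h := map_charpoly_eq_det (algebraMap K[X] (RatFunc K)) A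
  rw [RatFunc.algebraMap_X] at h
  exact h ▸ RatFunc.algebraMap_ne_zero A.charpoly_monic.ne_zero

theorem ratFuncEval_transferMatrix (f : K →+* L) {z : L}
    (hz : (z • (1 : Matrix n n L) - A.map f).det ≠ 0) :
    (transferMatrix (A.map RatFunc.C) (B.map RatFunc.C) (C.map RatFunc.C) (D.map RatFunc.C)
        RatFunc.X).map (RatFunc.eval f z) =
      transferMatrix (A.map f) (B.map f) (C.map f) (D.map f) z := by
  have hf : (eval₂RingHom f z).comp Polynomial.C = f := RingHom.ext fun x => eval₂_C f z
  have hχ : A.charpoly.eval₂ f z ≠ 0 := by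
    have h := map_charpoly_eq_det (eval₂RingHom f z) A
    rw [hf, coe_eval₂RingHom, eval₂_X] at h
    rwa [h]
  have hrat := transferMatrix_map_eq_smul_map_transferNum (B := B) (C := C) (D := D)
    (algebraMap K[X] (RatFunc K)) (RatFunc.algebraMap_ne_zero A.charpoly_monic.ne_zero)
  have heval := transferMatrix_map_eq_smul_map_transferNum (B := B) (C := C) (D := D)
    (eval₂RingHom f z) hχ
  rw [hf, coe_eval₂RingHom, eval₂_X] at heval
  rw [RatFunc.algebraMap_X] at hrat
  rw [heval]
  ext i j
  refine (congrArg (RatFunc.eval f z) (congrFun₂ hrat i j)).trans ?_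
  simp only [Matrix.smul_apply, Matrix.map_apply, smul_eq_mul, inv_mul_eq_div]
  exact ratFuncEval_div f z _ hχ

end Evaluation

section Analytic

variable {𝕜 E : Type*} [NontriviallyNormedField 𝕜] [NormedAddCommGroup E] [NormedSpace 𝕜 E]
  {m n : Type*} [Fintype n] [DecidableEq n]

theorem analyticAt_det {M : E → Matrix n n 𝕜} {z : E}
    (hM : ∀ i j, AnalyticAt 𝕜 (fun w => M w i j) z) : AnalyticAt 𝕜 (fun w => (M w).det) z := by
  simp only [det_apply']
  exact Finset.univ.analyticAt_fun_sum fun σ _ =>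
    analyticAt_const.mul (Finset.univ.analyticAt_fun_prod fun i _ => hM (σ i) i)

theorem analyticAt_nonsing_inv_apply {M : E → Matrix n n 𝕜} {z : E}
    (hM : ∀ i j, AnalyticAt 𝕜 (fun w => M w i j) z) (hz : (M z).det ≠ 0) (i j : n) :
    AnalyticAt 𝕜 (fun w => (M w)⁻¹ i j) z := by
  have hadj : AnalyticAt 𝕜 (fun w => (M w).adjugate i j) z := by
    simp only [adjugate_apply]
    refine analyticAt_det fun k l => ?_
    by_cases h : k = j
    · subst h; simpa only [updateRow_self] using analyticAt_const
    · simpa only [updateRow_ne h] using hM k l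
  simp only [inv_def, Matrix.smul_apply, Ring.inverse_eq_inv', smul_eq_mul]
  exact ((analyticAt_det hM).inv hz).mul hadj

theorem analyticAt_transferMatrix_apply {A : Matrix n n 𝕜} (B : Matrix n m 𝕜) (C : Matrix m n 𝕜)
    (D : Matrix m m 𝕜) {z : 𝕜} (hz : (z • (1 : Matrix n n 𝕜) - A).det ≠ 0) (i j : m) :
    AnalyticAt 𝕜 (fun w => transferMatrix A B C D w i j) z := by
  have hinv := analyticAt_nonsing_inv_apply (M := fun w => w • (1 : Matrix n n 𝕜) - A)
    (fun k l => (analyticAt_id.mul analyticAt_const).sub analyticAt_const) hz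
  simp only [transferMatrix, Matrix.add_apply, Matrix.mul_apply]
  exact (Finset.univ.analyticAt_fun_sum fun k _ =>
    (Finset.univ.analyticAt_fun_sum fun l _ => analyticAt_const.mul (hinv l k)).mul
      analyticAt_const).add analyticAt_const

theorem finite_setOf_det_resolvent_eq_zero {K : Type*} [Field K] (A : Matrix n n K) :
    {z : K | (z • (1 : Matrix n n K) - A).det = 0}.Finite := by
  refine (finite_setOfPred_isRoot A.charpoly_monic.ne_zero).subset fun z hz => ?_
  rwa [Set.mem_ofPred_eq, IsRoot.def, eval_charpoly, scalar_apply, ← smul_one_eq_diagonal]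

theorem isOpen_setOf_det_resolvent_ne_zero (A : Matrix n n 𝕜) :
    IsOpen {z : 𝕜 | (z • (1 : Matrix n n 𝕜) - A).det ≠ 0} := by
  have h := (finite_setOf_det_resolvent_eq_zero A).isClosed.isOpen_compl
  exact h

end Analytic

section Realization

variable {m n k : ℕ} {G : Matrix (Fin m) (Fin m) (RatFunc ℝ)}
  {A : Matrix (Fin n) (Fin n) ℝ} {B : Matrix (Fin n) (Fin m) ℝ}
  {C : Matrix (Fin m) (Fin n) ℝ} {D : Matrix (Fin m) (Fin m) ℝ}

theorem isRealization_iff : IsRealization G A B C D ↔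
    G = transferMatrix (A.map RatFunc.C) (B.map RatFunc.C) (C.map RatFunc.C) (D.map RatFunc.C)
      RatFunc.X := Iff.rfl

theorem IsRealization.transferEval_eq (h : IsRealization G A B C D) {z : ℂ}
    (hz : (z • (1 : Matrix (Fin n) (Fin n) ℂ) - A.map ι).det ≠ 0) :
    transferEval G z = transferMatrix (A.map ι) (B.map ι) (C.map ι) (D.map ι) z := by
  rw [transferEval, isRealization_iff.mp h, ratFuncEval_transferMatrix _ hz]

theorem IsRealization.analyticAt_transferEval (h : IsRealization G A B C D) {z : ℂ}
    (hz : (z • (1 : Matrix (Fin n) (Fin n) ℂ) - A.map ι).det ≠ 0) (i j : Fin m) :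
    AnalyticAt ℂ (fun w => transferEval G w i j) z := by
  refine (analyticAt_transferMatrix_apply (B.map ι) (C.map ι) (D.map ι) hz i j).congr ?_
  filter_upwards [(isOpen_setOf_det_resolvent_ne_zero _).mem_nhds hz] with w hw
  rw [h.transferEval_eq hw]

theorem IsRealization.transpose (h : IsRealization G A B C D) :
    IsRealization Gᵀ Aᵀ Cᵀ Bᵀ Dᵀ := by
  rw [isRealization_iff] at h ⊢
  rw [h, transpose_transferMatrix]
  rfl

theorem IsRealization.of_intertwine {A' : Matrix (Fin k) (Fin k) ℝ} {B' : Matrix (Fin k) (Fin m) ℝ}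
    {P : Matrix (Fin n) (Fin k) ℝ} (h : IsRealization G A (P * B') C D) (hA : A * P = P * A') :
    IsRealization G A' B' (C * P) D := by
  rw [isRealization_iff] at h ⊢
  rw [h, Matrix.map_mul, Matrix.map_mul]
  refine transferMatrix_intertwine ?_ (det_ratFunc_resolvent_ne_zero A)
    (det_ratFunc_resolvent_ne_zero A')
  rw [← Matrix.map_mul, hA, Matrix.map_mul]

theorem IsMinimalRealization.transpose (h : IsMinimalRealization G A B C D) :
    IsMinimalRealization Gᵀ Aᵀ Cᵀ Bᵀ Dᵀ :=
  ⟨h.1.transpose, fun k A' B' C' D' h' => h.2 k A'ᵀ C'ᵀ B'ᵀ D'ᵀ h'.transpose⟩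

end Realization

section Controllability

variable {R E U Y : Type*} [CommRing R] [AddCommGroup E] [Module R E] [AddCommGroup U] [Module R U]
  [AddCommGroup Y] [Module R Y]

/-- Controllability of the pair `(A, B)`, in the form that avoids dimension counting: the only
`A`-invariant subspace containing the range of `B` is the whole state space. -/
def IsControllable (A : Module.End R E) (B : U →ₗ[R] E) : Prop :=
  ∀ W : Submodule R E, (∀ x ∈ W, A x ∈ W) → (∀ u, B u ∈ W) → W = ⊤

/-- Observability of the pair `(A, C)`, in the form dual to `IsControllable`: the only `A`-invariant
subspace of the kernel of `C` is trivial. -/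
def IsObservable (A : Module.End R E) (C : E →ₗ[R] Y) : Prop :=
  ∀ W : Submodule R E, (∀ x ∈ W, A x ∈ W) → (∀ x ∈ W, C x = 0) → W = ⊥

/-- If `W` is invariant and contains the range of `(1 + A) N`, its preimage under `1 + A` is
invariant and contains the range of `N`, hence that of `B = (1 - A) N`. -/
theorem IsControllable.cayley {A : Module.End R E} {B N : U →ₗ[R] E} (h : IsControllable A B)
    (hN : (1 - A) ∘ₗ N = B) (hA : Function.Surjective (1 + A : Module.End R E)) :
    IsControllable A ((1 + A) ∘ₗ N) := by
  intro W hWA hWN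
  have hcomap : W.comap (1 + A : Module.End R E) = ⊤ := by
    have hinv : ∀ x ∈ W.comap (1 + A : Module.End R E),
        A x ∈ W.comap (1 + A : Module.End R E) := fun x hx => by
      have hcomm : (1 + A : Module.End R E) (A x) = A ((1 + A : Module.End R E) x) := by simp
      rw [Submodule.mem_comap] at hx ⊢
      rw [hcomm]
      exact hWA _ hx
    refine h _ hinv fun u => ?_
    have hNu : N u ∈ W.comap (1 + A : Module.End R E) := hWN u
    rw [← hN]
    exact Submodule.sub_mem _ hNu (hinv _ hNu)
  refine Submodule.eq_top_iff'.mpr fun y => ?_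
  obtain ⟨x, rfl⟩ := hA y
  exact (hcomap ▸ Submodule.mem_top : x ∈ W.comap (1 + A : Module.End R E))

theorem IsControllable.isObservable_of_transpose {m n : Type*} [Fintype m] [Fintype n]
    {A : Matrix n n R} {C : Matrix m n R} (h : IsControllable Aᵀ.mulVecLin Cᵀ.mulVecLin) :
    IsObservable A.mulVecLin C.mulVecLin := by
  classical
  intro W hA hC
  let W' : Submodule R (n → R) :=
    { carrier := {ξ | ∀ x ∈ W, ξ ⬝ᵥ x = 0}
      add_mem' := fun ha hb x hx => by rw [add_dotProduct, ha x hx, hb x hx, add_zero]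
      zero_mem' := fun x _ => zero_dotProduct x
      smul_mem' := fun c ξ hξ x hx => by rw [smul_dotProduct, hξ x hx, smul_zero] }
  have htop : W' = ⊤ := h W'
    (fun ξ hξ x hx => by
      rw [mulVecLin_apply, mulVec_transpose, ← dotProduct_mulVec]; exact hξ _ (hA x hx))
    (fun y x hx => by
      rw [mulVecLin_apply, mulVec_transpose, ← dotProduct_mulVec]
      exact (congrArg (y ⬝ᵥ ·) (hC x hx)).trans (dotProduct_zero y))
  refine (Submodule.eq_bot_iff W).mpr fun x hx => dotProduct_eq_zero x fun ξ => ?_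
  have hξ : ξ ∈ W' := htop ▸ Submodule.mem_top
  rw [dotProduct_comm]
  exact hξ x hx

theorem IsControllable.map_algebraMap {K L m n : Type*} [Field K] [Field L] [Algebra K L]
    [Fintype m] [Fintype n] {A : Matrix n n K} {B : Matrix n m K}
    (h : IsControllable A.mulVecLin B.mulVecLin) :
    IsControllable (A.map (algebraMap K L)).mulVecLin (B.map (algebraMap K L)).mulVecLin := by
  classical
  intro W hA hB
  let W' := (W.restrictScalars K).comap ((Algebra.linearMap K L).compLeft n)
  have htop : W' = ⊤ := h W'
    (fun x hx => by
      change algebraMap K L ∘ (A *ᵥ x) ∈ W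
      rw [comp_mulVec]
      exact hA _ hx)
    (fun u => by
      change algebraMap K L ∘ (B *ᵥ u) ∈ W
      rw [comp_mulVec]
      exact hB _)
  rw [← top_le_iff, ← (Pi.basisFun L n).span_eq, Submodule.span_le]
  rintro - ⟨i, rfl⟩
  have hi : Pi.single i 1 ∈ W' := htop ▸ Submodule.mem_top
  have hbasis : (Algebra.linearMap K L).compLeft n (Pi.single i 1) = Pi.basisFun L n i := by
    ext j
    by_cases hj : j = i
    · subst hj; simp
    · simp [hj]
  exact hbasis ▸ hi

variable {m n : ℕ} {G : Matrix (Fin m) (Fin m) (RatFunc ℝ)}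
  {A : Matrix (Fin n) (Fin n) ℝ} {B : Matrix (Fin n) (Fin m) ℝ}
  {C : Matrix (Fin m) (Fin n) ℝ} {D : Matrix (Fin m) (Fin m) ℝ}

theorem IsMinimalRealization.isControllable (h : IsMinimalRealization G A B C D) :
    IsControllable A.mulVecLin B.mulVecLin := by
  intro W hA hB
  by_contra hW
  have hlt : Module.finrank ℝ W < n := by simpa using Submodule.finrank_lt hW
  let b := Module.finBasis ℝ W
  let P := LinearMap.toMatrix b (Pi.basisFun ℝ (Fin n)) W.subtype
  let A' := LinearMap.toMatrix b b (A.mulVecLin.restrict hA)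
  let B' := LinearMap.toMatrix (Pi.basisFun ℝ (Fin m)) b (B.mulVecLin.codRestrict W hB)
  have hmat : ∀ {l : ℕ} (M : Matrix (Fin n) (Fin l) ℝ),
      LinearMap.toMatrix (Pi.basisFun ℝ (Fin l)) (Pi.basisFun ℝ (Fin n)) M.mulVecLin = M :=
    fun M => by rw [← toLin'_apply', ← toLin_eq_toLin', LinearMap.toMatrix_toLin]
  have hAP : A * P = P * A' := by
    rw [← hmat A, ← LinearMap.toMatrix_comp, ← LinearMap.toMatrix_comp]
    rfl
  have hBP : B = P * B' := by
    rw [← hmat B, ← LinearMap.toMatrix_comp]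
    rfl
  exact hlt.not_ge (h.2 _ A' B' (C * P) D ((hBP ▸ h.1).of_intertwine hAP))

theorem IsMinimalRealization.isObservable (h : IsMinimalRealization G A B C D) :
    IsObservable A.mulVecLin C.mulVecLin :=
  h.transpose.isControllable.isObservable_of_transpose

end Controllability

section Poles

variable {𝕜 : Type*} [NontriviallyNormedField 𝕜] {m n : Type*} [Fintype m] [Fintype n]
  [DecidableEq n] {A : Matrix n n 𝕜} {C : Matrix m n 𝕜} {z₀ : 𝕜}

theorem eventually_det_resolvent_ne_zero (A : Matrix n n 𝕜) (z₀ : 𝕜) :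
    ∀ᶠ z in 𝓝[≠] z₀, (z • (1 : Matrix n n 𝕜) - A).det ≠ 0 :=
  nhdsNE_le_cofinite z₀ (finite_setOf_det_resolvent_eq_zero A).compl_mem_cofinite

theorem resolvent_mulVec_mulVec {K : Type*} [Field K] {A : Matrix n n K} {z : K}
    (hz : (z • (1 : Matrix n n K) - A).det ≠ 0) (b : n → K) :
    (z • (1 : Matrix n n K) - A)⁻¹ *ᵥ (A *ᵥ b) =
      z • ((z • (1 : Matrix n n K) - A)⁻¹ *ᵥ b) - b := by
  set R := z • (1 : Matrix n n K) - A with hR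
  have hA : A = z • (1 : Matrix n n K) - R := by rw [hR, sub_sub_cancel]
  rw [hA, sub_mulVec, mulVec_sub, smul_mulVec, one_mulVec, mulVec_smul, mulVec_mulVec,
    nonsing_inv_mul _ hz.isUnit, one_mulVec]

theorem isBigO_resolvent_mulVec {b : n → 𝕜}
    (hO : (fun z => C *ᵥ ((z • (1 : Matrix n n 𝕜) - A)⁻¹ *ᵥ b)) =O[𝓝[≠] z₀] fun _ => (1 : ℝ)) :
    (fun z => C *ᵥ ((z • (1 : Matrix n n 𝕜) - A)⁻¹ *ᵥ (A *ᵥ b))) =O[𝓝[≠] z₀]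
      fun _ => (1 : ℝ) := by
  have hz : (fun z : 𝕜 => z) =O[𝓝[≠] z₀] fun _ => (1 : ℝ) :=
    (tendsto_id'.mpr nhdsWithin_le_nhds).isBigO_one ℝ
  have hsmul := hz.smul hO
  simp only [smul_eq_mul, mul_one] at hsmul
  refine (hsmul.sub (isBigO_const_const (C *ᵥ b) one_ne_zero (𝓝[≠] z₀))).congr' ?_ .rfl
  filter_upwards [eventually_det_resolvent_ne_zero A z₀] with z hz
  rw [resolvent_mulVec_mulVec hz, mulVec_sub, mulVec_smul]

theorem mulVec_eq_zero_of_isBigO_resolvent {v : n → 𝕜} (hv : A *ᵥ v = z₀ • v)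
    (hO : (fun z => C *ᵥ ((z • (1 : Matrix n n 𝕜) - A)⁻¹ *ᵥ v)) =O[𝓝[≠] z₀] fun _ => (1 : ℝ)) :
    C *ᵥ v = 0 := by
  have hsub : Tendsto (fun z => z - z₀) (𝓝[≠] z₀) (𝓝 0) :=
    (tendsto_sub_nhds_zero_iff.mpr tendsto_id).mono_left nhdsWithin_le_nhds
  have hlim := ((isLittleO_one_iff ℝ).mpr hsub).smul_isBigO hO
  simp only [smul_eq_mul, mul_one] at hlim
  refine tendsto_nhds_unique tendsto_const_nhds (((isLittleO_one_iff ℝ).mp hlim).congr' ?_)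
  filter_upwards [eventually_det_resolvent_ne_zero A z₀] with z hz
  have h := resolvent_mulVec_mulVec hz v
  rw [hv, mulVec_smul, eq_sub_iff_add_eq] at h
  rw [← mulVec_smul, sub_smul, ← h, add_sub_cancel_left]

/-- Unbounded resolvent modes are excluded on the controllable subspace by the bound, and an
eigenvector at `z₀` would be an unobservable one. -/
theorem det_resolvent_ne_zero_of_isBigO {B : Matrix n m 𝕜}
    (hctrl : IsControllable A.mulVecLin B.mulVecLin) (hobs : IsObservable A.mulVecLin C.mulVecLin)
    (hO : ∀ u, (fun z => C *ᵥ ((z • (1 : Matrix n n 𝕜) - A)⁻¹ *ᵥ (B *ᵥ u))) =O[𝓝[≠] z₀]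
      fun _ => (1 : ℝ)) :
    (z₀ • (1 : Matrix n n 𝕜) - A).det ≠ 0 := by
  let W : Submodule 𝕜 (n → 𝕜) :=
    { carrier := {b | (fun z => C *ᵥ ((z • (1 : Matrix n n 𝕜) - A)⁻¹ *ᵥ b)) =O[𝓝[≠] z₀]
        fun _ => (1 : ℝ)}
      add_mem' := fun ha hb => by
        simpa only [Set.mem_ofPred_eq, mulVec_add] using IsBigO.add ha hb
      zero_mem' := by simpa only [Set.mem_ofPred_eq, mulVec_zero] using isBigO_zero _ _
      smul_mem' := fun c b hb => by
        simp only [Set.mem_ofPred_eq, mulVec_smul]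
        exact IsBigO.const_smul_left hb c }
  have hW : W = ⊤ := hctrl W (fun b hb => isBigO_resolvent_mulVec hb) hO
  have hker : ∀ v, (z₀ • (1 : Matrix n n 𝕜) - A) *ᵥ v = 0 ↔ A *ᵥ v = z₀ • v := fun v => by
    rw [sub_mulVec, smul_mulVec, one_mulVec, sub_eq_zero, eq_comm]
  have hbot : LinearMap.ker (z₀ • (1 : Matrix n n 𝕜) - A).mulVecLin = ⊥ := by
    refine hobs _ (fun v hv => ?_) fun v hv => ?_
    · rw [LinearMap.mem_ker, mulVecLin_apply, hker] at hv ⊢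
      rw [mulVecLin_apply, hv, mulVec_smul, hv]
    · exact mulVec_eq_zero_of_isBigO_resolvent ((hker v).mp hv)
        (hW ▸ Submodule.mem_top : v ∈ W)
  rw [Ne, ← exists_mulVec_eq_zero_iff]
  rintro ⟨v, hv0, hv⟩
  exact hv0 ((Submodule.eq_bot_iff _).mp hbot v hv)

theorem IsMinimalRealization.det_resolvent_ne_zero {m n : ℕ}
    {G : Matrix (Fin m) (Fin m) (RatFunc ℝ)}
    {A : Matrix (Fin n) (Fin n) ℝ} {B : Matrix (Fin n) (Fin m) ℝ}
    {C : Matrix (Fin m) (Fin n) ℝ} {D : Matrix (Fin m) (Fin m) ℝ}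
    (h : IsMinimalRealization G A B C D) {z₀ : ℂ} (hcont : ContinuousAt (transferEval G) z₀) :
    (z₀ • (1 : Matrix (Fin n) (Fin n) ℂ) - A.map ι).det ≠ 0 := by
  have hobs : IsObservable (A.map ι).mulVecLin (C.map ι).mulVecLin :=
    h.transpose.isControllable.map_algebraMap.isObservable_of_transpose
  refine det_resolvent_ne_zero_of_isBigO h.isControllable.map_algebraMap hobs fun u => ?_
  have hlim : Tendsto (fun z => (transferEval G z - D.map ι) *ᵥ u) (𝓝[≠] z₀)
      (𝓝 ((transferEval G z₀ - D.map ι) *ᵥ u)) :=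
    ((continuous_id.matrix_mulVec continuous_const).continuousAt.tendsto.comp
      (hcont.sub continuousAt_const)).mono_left nhdsWithin_le_nhds
  refine (hlim.isBigO_one ℝ).congr' ?_ .rfl
  filter_upwards [eventually_det_resolvent_ne_zero (A.map ι) z₀] with z hz
  rw [h.1.transferEval_eq hz, transferMatrix, add_sub_cancel_right, mulVec_mulVec, mulVec_mulVec]

end Poles

section QuadraticInfimum

variable {E : Type*} [AddCommGroup E] [Module ℝ E]

theorem quadraticForm_reflection (Q : QuadraticForm ℝ E) (c s : ℝ) (x y : E) :
    Q (c • x + s • y) + Q (s • x - c • y) = (c ^ 2 + s ^ 2) * (Q x + Q y) := by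
  rw [sub_eq_add_neg, ← neg_smul, QuadraticMap.map_add Q, QuadraticMap.map_add Q]
  simp only [QuadraticMap.map_smul, QuadraticMap.polar_smul_left, QuadraticMap.polar_smul_right,
    smul_eq_mul]
  ring

section Reflection

variable {V : E → ℝ} (hV : ∀ (c s : ℝ) (x y : E),
  V (c • x + s • y) + V (s • x - c • y) ≤ (c ^ 2 + s ^ 2) * (V x + V y))

include hV

theorem map_zero_of_reflection_le : V 0 = 0 := by
  have h₀ := hV 0 0 0 0
  have h₁ := hV 1 1 0 0
  simp only [smul_zero, add_zero, sub_zero] at h₀ h₁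
  linarith

theorem map_smul_of_reflection_le (t : ℝ) (x : E) : V (t • x) = t ^ 2 * V x := by
  have hle : ∀ (t : ℝ) x, V (t • x) ≤ t ^ 2 * V x := fun t x => by
    simpa [map_zero_of_reflection_le hV] using hV t 0 x 0
  refine (hle t x).antisymm ?_
  rcases eq_or_ne t 0 with rfl | ht
  · simp [map_zero_of_reflection_le hV]
  · have h := mul_le_mul_of_nonneg_left (hle t⁻¹ (t • x)) (sq_nonneg t)
    rwa [inv_smul_smul₀ ht, ← mul_assoc, ← mul_pow, mul_inv_cancel₀ ht, one_pow, one_mul] at h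

/-- The reverse inequality is the hypothesis at the reflected pair, as reflecting twice multiplies
both vectors by `c ^ 2 + s ^ 2`. -/
theorem map_reflection_of_reflection_le (c s : ℝ) (x y : E) :
    V (c • x + s • y) + V (s • x - c • y) = (c ^ 2 + s ^ 2) * (V x + V y) := by
  refine (hV c s x y).antisymm ?_
  have h := hV c s (c • x + s • y) (s • x - c • y)
  have hx : c • (c • x + s • y) + s • (s • x - c • y) = (c ^ 2 + s ^ 2) • x := by module
  have hy : s • (c • x + s • y) - c • (s • x - c • y) = (c ^ 2 + s ^ 2) • y := by module
  rw [hx, hy, map_smul_of_reflection_le hV, map_smul_of_reflection_le hV] at h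
  rcases (add_nonneg (sq_nonneg c) (sq_nonneg s)).eq_or_lt with h0 | hpos
  · obtain ⟨rfl, rfl⟩ : c = 0 ∧ s = 0 := by constructor <;> nlinarith
    simp [map_zero_of_reflection_le hV]
  · refine le_of_mul_le_mul_left ?_ hpos
    linarith

theorem polar_eq_of_reflection_le (x y : E) :
    2 * QuadraticMap.polar V x y = V (x + y) - V (x - y) := by
  have h := map_reflection_of_reflection_le hV 1 1 x y
  simp only [one_smul] at h
  rw [QuadraticMap.polar]
  linarith

theorem polar_add_left_of_reflection_le (x y z : E) : QuadraticMap.polar V (x + y) z =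
    QuadraticMap.polar V x z + QuadraticMap.polar V y z := by
  have hpar : ∀ x y, V (x + y) + V (x - y) = 2 * (V x + V y) := fun x y => by
    have h := map_reflection_of_reflection_le hV 1 1 x y
    simp only [one_smul] at h
    linarith
  have h₁ := hpar (x + z) y
  have h₂ := hpar x (z - y)
  have h₃ := hpar (x + y) z
  have h₄ := hpar z y
  rw [show x + z + y = x + y + z by abel, show x + z - y = x + (z - y) by abel] at h₁
  rw [show x - (z - y) = x + y - z by abel] at h₂
  simp only [QuadraticMap.polar, add_comm y z]
  linarith

theorem polar_smul_left_of_reflection_le (t : ℝ) (x y : E) :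
    QuadraticMap.polar V (t • x) y = t * QuadraticMap.polar V x y := by
  have hneg : ∀ x, V (-x) = V x := fun x => by
    simpa using map_smul_of_reflection_le hV (-1) x
  have hsq : ∀ c : ℝ, QuadraticMap.polar V (c ^ 2 • x) y = c ^ 2 * QuadraticMap.polar V x y := by
    intro c
    have h₁ := map_reflection_of_reflection_le hV c 1 (c • x) y
    have h₂ := map_reflection_of_reflection_le hV c 1 (c • x) (-y)
    rw [smul_smul, ← sq, one_smul, one_smul, ← smul_sub, map_smul_of_reflection_le hV c] at h₁
    rw [smul_smul, ← sq, one_smul, one_smul, ← smul_sub, map_smul_of_reflection_le hV c (x - -y),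
      hneg, sub_neg_eq_add, ← sub_eq_add_neg] at h₂
    linear_combination 1 / 2 * polar_eq_of_reflection_le hV (c ^ 2 • x) y -
      c ^ 2 / 2 * polar_eq_of_reflection_le hV x y + 1 / 2 * h₁ - 1 / 2 * h₂
  have hpolar_neg : QuadraticMap.polar V (-t • x) y = -QuadraticMap.polar V (t • x) y := by
    have h := polar_eq_of_reflection_le hV (-t • x) y
    rw [neg_smul, ← hneg (-(t • x) + y), ← hneg (-(t • x) - y), neg_add, neg_sub, neg_neg,
      sub_neg_eq_add, ← sub_eq_add_neg, add_comm y] at h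
    rw [neg_smul]
    linarith [polar_eq_of_reflection_le hV (t • x) y]
  rcases le_total 0 t with ht | ht
  · simpa only [Real.sq_sqrt ht] using hsq (√t)
  · have h := hsq (√(-t))
    rw [Real.sq_sqrt (neg_nonneg.mpr ht), hpolar_neg] at h
    linarith

theorem exists_quadraticForm_of_reflection_le : ∃ Q : QuadraticForm ℝ E, ∀ x, Q x = V x :=
  ⟨QuadraticMap.ofPolar V
    (fun t x => by rw [map_smul_of_reflection_le hV, smul_eq_mul, sq])
    (polar_add_left_of_reflection_le hV)
    (polar_smul_left_of_reflection_le hV), fun _ => rfl⟩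

end Reflection

open scoped Pointwise in
theorem exists_quadraticForm_eq_sInf {S : E → Set ℝ} (hne : ∀ x, (S x).Nonempty)
    (hbdd : ∀ x, BddBelow (S x))
    (hS : ∀ (c s : ℝ) (x y : E), ∀ e ∈ S x, ∀ f ∈ S y, ∃ e' ∈ S (c • x + s • y),
      ∃ f' ∈ S (s • x - c • y), e' + f' = (c ^ 2 + s ^ 2) * (e + f)) :
    ∃ Q : QuadraticForm ℝ E, ∀ x, Q x = sInf (S x) := by
  refine exists_quadraticForm_of_reflection_le fun c s x y => ?_
  rw [← csInf_add (hne x) (hbdd x) (hne y) (hbdd y), ← smul_eq_mul,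
    ← Real.sInf_smul_of_nonneg (by positivity)]
  refine le_csInf (((hne x).add (hne y)).smul_set) ?_
  rintro - ⟨-, ⟨e, he, f, hf, rfl⟩, rfl⟩
  obtain ⟨e', he', f', hf', heq⟩ := hS c s x y e he f hf
  exact (add_le_add (csInf_le (hbdd _) he') (csInf_le (hbdd _) hf')).trans_eq heq

end QuadraticInfimum

section Storage

variable {E U : Type*} [AddCommGroup E] [Module ℝ E] [AddCommGroup U] [Module ℝ U]
  (A : Module.End ℝ E) (B : U →ₗ[ℝ] E) (s : QuadraticForm ℝ (E × U))

/-- The trajectory of `x (k + 1) = A (x k) + B (u k)` that starts at rest. -/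
def stateTrajectory (u : ℕ → U) : ℕ → E
  | 0 => 0
  | k + 1 => A (stateTrajectory u k) + B (u k)

/-- The energy supplied up to time `T` along the trajectory from rest driven by `u`, when the supply
rate is the quadratic form `s` in the state and the input. -/
def suppliedEnergy (u : ℕ → U) (T : ℕ) : ℝ :=
  ∑ k ∈ Finset.range T, s (stateTrajectory A B u k, u k)

theorem stateTrajectory_smul_add_smul (c d : ℝ) (u v : ℕ → U) (k : ℕ) :
    stateTrajectory A B (c • u + d • v) k =
      c • stateTrajectory A B u k + d • stateTrajectory A B v k := by
  induction k with
  | zero => simp only [stateTrajectory, smul_zero, add_zero]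
  | succ k ih =>
    simp only [stateTrajectory, ih, Pi.add_apply, Pi.smul_apply, map_add, map_smul, smul_add]
    abel

theorem suppliedEnergy_reflection (c d : ℝ) (u v : ℕ → U) (T : ℕ) :
    suppliedEnergy A B s (c • u + d • v) T + suppliedEnergy A B s (d • u + (-c) • v) T =
      (c ^ 2 + d ^ 2) * (suppliedEnergy A B s u T + suppliedEnergy A B s v T) := by
  simp only [suppliedEnergy, ← Finset.sum_add_distrib, Finset.mul_sum,
    stateTrajectory_smul_add_smul]
  refine Finset.sum_congr rfl fun k _ => ?_
  rw [← quadraticForm_reflection, sub_eq_add_neg, ← neg_smul]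
  rfl

theorem stateTrajectory_congr {u v : ℕ → U} {T : ℕ} (h : ∀ k < T, u k = v k) :
    stateTrajectory A B u T = stateTrajectory A B v T := by
  induction T with
  | zero => rfl
  | succ T ih =>
    rw [stateTrajectory, stateTrajectory, ih fun k hk => h k (hk.trans T.lt_succ_self),
      h T T.lt_succ_self]

theorem suppliedEnergy_congr {u v : ℕ → U} {T : ℕ} (h : ∀ k < T, u k = v k) :
    suppliedEnergy A B s u T = suppliedEnergy A B s v T :=
  Finset.sum_congr rfl fun k hk => by
    have hkT := Finset.mem_range.mp hk
    rw [stateTrajectory_congr A B fun j hj => h j (hj.trans hkT), h k hkT]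

theorem stateTrajectory_update_succ (u : ℕ → U) (T : ℕ) (w : U) :
    stateTrajectory A B (Function.update u T w) (T + 1) = A (stateTrajectory A B u T) + B w := by
  rw [stateTrajectory, Function.update_self,
    stateTrajectory_congr A B fun k hk => Function.update_of_ne hk.ne w u]

theorem suppliedEnergy_update_succ (u : ℕ → U) (T : ℕ) (w : U) :
    suppliedEnergy A B s (Function.update u T w) (T + 1) =
      suppliedEnergy A B s u T + s (stateTrajectory A B u T, w) := by
  have h : ∀ k < T, Function.update u T w k = u k := fun k hk => Function.update_of_ne hk.ne w u
  rw [suppliedEnergy, Finset.sum_range_succ, Function.update_self, stateTrajectory_congr A B h]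
  exact congrArg (· + _) (suppliedEnergy_congr A B s h)

/-- The input `u` delayed by one step, so that the system stays at rest for one step before it is
driven by `u`. -/
def delayedInput (u : ℕ → U) : ℕ → U
  | 0 => 0
  | k + 1 => u k

theorem stateTrajectory_delayedInput_succ (u : ℕ → U) (k : ℕ) :
    stateTrajectory A B (delayedInput u) (k + 1) = stateTrajectory A B u k := by
  induction k with
  | zero => simp only [stateTrajectory, delayedInput, map_zero, add_zero]
  | succ k ih => rw [stateTrajectory, ih, stateTrajectory, delayedInput]

theorem suppliedEnergy_delayedInput_succ (u : ℕ → U) (T : ℕ) :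
    suppliedEnergy A B s (delayedInput u) (T + 1) = suppliedEnergy A B s u T := by
  simp only [suppliedEnergy, Finset.sum_range_succ', stateTrajectory_delayedInput_succ]
  exact add_eq_left.mpr (QuadraticMap.map_zero s)

theorem exists_delayed_input {T T' : ℕ} (hT : T ≤ T') (u : ℕ → U) : ∃ v,
    stateTrajectory A B v T' = stateTrajectory A B u T ∧
      suppliedEnergy A B s v T' = suppliedEnergy A B s u T := by
  induction T', hT using Nat.le_induction with
  | base => exact ⟨u, rfl, rfl⟩
  | succ T' _ ih =>
    obtain ⟨v, hx, he⟩ := ih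
    exact ⟨delayedInput v, (stateTrajectory_delayedInput_succ A B v T').trans hx,
      (suppliedEnergy_delayedInput_succ A B s v T').trans he⟩

theorem exists_simultaneous_inputs (T T' : ℕ) (u v : ℕ → U) : ∃ N u' v',
    stateTrajectory A B u' N = stateTrajectory A B u T ∧
    suppliedEnergy A B s u' N = suppliedEnergy A B s u T ∧
    stateTrajectory A B v' N = stateTrajectory A B v T' ∧
    suppliedEnergy A B s v' N = suppliedEnergy A B s v T' := by
  obtain ⟨u', hu⟩ := exists_delayed_input A B s (le_max_left T T') u
  obtain ⟨v', hv⟩ := exists_delayed_input A B s (le_max_right T T') v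
  exact ⟨_, u', v', hu.1, hu.2, hv.1, hv.2⟩

variable {A B s}

theorem IsControllable.exists_stateTrajectory_eq (h : IsControllable A B) (x : E) :
    ∃ u T, stateTrajectory A B u T = x := by
  let W : Submodule ℝ E :=
    { carrier := {x | ∃ u T, stateTrajectory A B u T = x}
      add_mem' := by
        rintro - - ⟨u, T, rfl⟩ ⟨v, T', rfl⟩
        obtain ⟨N, u', v', hu, -, hv, -⟩ := exists_simultaneous_inputs A B 0 T T' u v
        exact ⟨(1 : ℝ) • u' + (1 : ℝ) • v', N, by
          rw [stateTrajectory_smul_add_smul, hu, hv, one_smul, one_smul]⟩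
      zero_mem' := ⟨0, 0, rfl⟩
      smul_mem' := by
        rintro c - ⟨u, T, rfl⟩
        exact ⟨c • u + (0 : ℝ) • u, T, by
          rw [stateTrajectory_smul_add_smul, zero_smul, add_zero]⟩ }
  have hW : W = ⊤ := by
    refine h W ?_ fun w => ⟨fun _ => w, 1, by simp only [stateTrajectory, map_zero, zero_add]⟩
    rintro - ⟨u, T, rfl⟩
    exact ⟨Function.update u T 0, T + 1, by rw [stateTrajectory_update_succ, map_zero, add_zero]⟩
  exact (hW ▸ Submodule.mem_top : x ∈ W)

/-- The storage function is the required supply: the least energy that drives the system from rest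
to the given state. -/
theorem IsControllable.exists_storage (h : IsControllable A B)
    (hs : ∀ u T, 0 ≤ suppliedEnergy A B s u T) :
    ∃ Q : QuadraticForm ℝ E, (∀ x, 0 ≤ Q x) ∧ ∀ x u, Q (A x + B u) ≤ Q x + s (x, u) := by
  let S : E → Set ℝ := fun x =>
    {e | ∃ u T, stateTrajectory A B u T = x ∧ suppliedEnergy A B s u T = e}
  have hne : ∀ x, (S x).Nonempty := fun x =>
    let ⟨u, T, hu⟩ := h.exists_stateTrajectory_eq x
    ⟨_, u, T, hu, rfl⟩
  have hlower : ∀ x, ∀ e ∈ S x, 0 ≤ e := by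
    rintro x - ⟨u, T, -, rfl⟩
    exact hs u T
  have hbdd : ∀ x, BddBelow (S x) := fun x => ⟨0, hlower x⟩
  obtain ⟨Q, hQ⟩ : ∃ Q : QuadraticForm ℝ E, ∀ x, Q x = sInf (S x) := by
    refine exists_quadraticForm_eq_sInf hne hbdd ?_
    rintro c d - - - ⟨u, T, rfl, rfl⟩ - ⟨v, T', rfl, rfl⟩
    obtain ⟨N, u', v', hu, hEu, hv, hEv⟩ := exists_simultaneous_inputs A B s T T' u v
    refine ⟨_, ⟨c • u' + d • v', N, ?_, rfl⟩, _, ⟨d • u' + (-c) • v', N, ?_, rfl⟩, ?_⟩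
    · rw [stateTrajectory_smul_add_smul, hu, hv]
    · rw [stateTrajectory_smul_add_smul, hu, hv, neg_smul, ← sub_eq_add_neg]
    · rw [suppliedEnergy_reflection, hEu, hEv]
  refine ⟨Q, fun x => hQ x ▸ le_csInf (hne x) (hlower x), fun x w => ?_⟩
  rw [hQ, hQ, ← sub_le_iff_le_add]
  refine le_csInf (hne x) ?_
  rintro - ⟨u, T, rfl, rfl⟩
  rw [sub_le_iff_le_add]
  exact csInf_le (hbdd _) ⟨_, _, stateTrajectory_update_succ A B u T w,
    suppliedEnergy_update_succ A B s u T w⟩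

end Storage

section CayleySupply

variable {E U : Type*} [AddCommGroup E] [Module ℝ E] [AddCommGroup U] [Module ℝ U]

/-- The supply rate pairing the input `u` with the output `y = x + N u` through `β`. For
`N = (1 - A)⁻¹ B` and `β u x = u ⬝ᵥ C *ᵥ x`, it makes the system with state map `A`, input map
`(1 + A) N`, output map `C` and feedthrough `C N` passive exactly when `(A, B, C, D)` is
negative imaginary. -/
def cayleySupply (β : U →ₗ[ℝ] E →ₗ[ℝ] ℝ) (N : U →ₗ[ℝ] E) : QuadraticForm ℝ (E × U) :=
  LinearMap.BilinMap.toQuadraticMap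
    (β.compl₁₂ (LinearMap.snd ℝ E U) (LinearMap.id.coprod N))

theorem cayleySupply_apply (β : U →ₗ[ℝ] E →ₗ[ℝ] ℝ) (N : U →ₗ[ℝ] E) (x : E) (u : U) :
    cayleySupply β N (x, u) = β u (x + N u) := rfl

theorem eq_polar_of_cayleySupply {A : Module.End ℝ E} {N : U →ₗ[ℝ] E}
    {β : U →ₗ[ℝ] E →ₗ[ℝ] ℝ} {Q : QuadraticForm ℝ E}
    (hQ : ∀ x u, Q (A x + ((1 + A) ∘ₗ N) u) ≤ Q x + cayleySupply β N (x, u)) (u : U) (w : E) :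
    β u w = QuadraticMap.polar Q (N u) (A w + w) := by
  have hquad : ∀ t : ℝ, 0 ≤ (Q w - Q (A w)) * (t * t) +
      (β u w - QuadraticMap.polar Q (N u) (A w + w)) * t + 0 := fun t => by
    have h := hQ (t • w - N u) u
    have hstate : A (t • w - N u) + ((1 + A) ∘ₗ N) u = t • A w + N u := by
      simp only [map_sub, map_smul, LinearMap.comp_apply, LinearMap.add_apply, Module.End.one_apply]
      abel
    rw [hstate, cayleySupply_apply, sub_add_cancel, map_smul, smul_eq_mul, sub_eq_add_neg,
      QuadraticMap.map_add Q, QuadraticMap.map_add Q] at h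
    simp only [QuadraticMap.map_smul, QuadraticMap.map_neg, QuadraticMap.polar_smul_left,
      QuadraticMap.polar_neg_right, smul_eq_mul] at h
    rw [QuadraticMap.polar_add_right, QuadraticMap.polar_comm Q (N u),
      QuadraticMap.polar_comm Q (N u)]
    linarith
  have hdiscrim := discrim_le_zero hquad
  rw [discrim, mul_zero, sub_zero] at hdiscrim
  exact sub_eq_zero.mp (pow_eq_zero_iff two_ne_zero |>.mp (hdiscrim.antisymm (sq_nonneg _)))

theorem exists_isSymm_dotProduct_mulVec_eq_polar {n : Type*} [Fintype n]
    (Q : QuadraticForm ℝ (n → ℝ)) :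
    ∃ X : Matrix n n ℝ, X.IsSymm ∧ ∀ x y, x ⬝ᵥ X *ᵥ y = QuadraticMap.polar Q x y := by
  classical
  have hX : ∀ x y, x ⬝ᵥ LinearMap.toMatrix₂' ℝ Q.polarBilin *ᵥ y = QuadraticMap.polar Q x y :=
    fun x y => by
      rw [← toLinearMap₂'_apply', toLinearMap₂'_toMatrix', QuadraticMap.polarBilin_apply_apply]
  refine ⟨LinearMap.toMatrix₂' ℝ Q.polarBilin, ?_, hX⟩
  ext i j
  rw [transpose_apply, LinearMap.toMatrix₂'_apply, LinearMap.toMatrix₂'_apply]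
  exact QuadraticMap.polar_comm Q _ _

end CayleySupply

section Lyapunov

variable {m n : Type*} [Fintype n]

theorem posDef_of_isObservable {A X : Matrix n n ℝ} {C : Matrix m n ℝ} (hX : X.PosSemidef)
    (hXA : (X - Aᵀ * X * A).PosSemidef) (hC : ∀ w, X *ᵥ (A *ᵥ w) = 0 → X *ᵥ w = 0 → C *ᵥ w = 0)
    (hobs : IsObservable A.mulVecLin C.mulVecLin) : X.PosDef := by
  classical
  have hinv : ∀ w, X *ᵥ w = 0 → X *ᵥ (A *ᵥ w) = 0 := fun w hw => by
    have h := hXA.dotProduct_mulVec_nonneg w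
    rw [← hX.dotProduct_mulVec_zero_iff]
    refine le_antisymm ?_ (hX.dotProduct_mulVec_nonneg _)
    rw [sub_mulVec, hw, zero_sub, dotProduct_neg, ← mulVec_mulVec, ← mulVec_mulVec,
      dotProduct_mulVec, vecMul_transpose] at h
    simpa only [star_trivial, neg_nonneg] using h
  have hker : LinearMap.ker X.mulVecLin = ⊥ :=
    hobs _ (fun w hw => hinv w hw) fun w hw => hC w (hinv w hw) hw
  rw [hX.posDef_iff_isUnit]
  exact mulVec_injective_iff_isUnit.mp (LinearMap.ker_eq_bot.mp hker)

theorem neg_transpose_mul_inv_mul {K : Type*} [Field K] [DecidableEq n] {A : Matrix n n K}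
    {B N : Matrix n m K} (hN : (1 - A) * N = B) (hA : (1 - A).det ≠ 0) :
    -(Bᵀ * (Aᵀ - 1)⁻¹) = Nᵀ := by
  have hNT : Bᵀ = -(Nᵀ * (Aᵀ - 1)) := by
    rw [← hN, transpose_mul, transpose_sub, transpose_one, ← Matrix.mul_neg, neg_sub]
  have hunit : IsUnit (Aᵀ - 1).det := by
    rw [← neg_sub, det_neg, ← transpose_one, ← transpose_sub, det_transpose]
    exact ((isUnit_one.neg).pow _).mul hA.isUnit
  rw [hNT, Matrix.neg_mul, neg_neg, mul_nonsing_inv_cancel_right _ _ hunit]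

theorem exists_lyapunov_of_suppliedEnergy_nonneg [Fintype m] [DecidableEq m] [DecidableEq n]
    {A : Matrix n n ℝ} {N : Matrix n m ℝ} {C : Matrix m n ℝ}
    (hctrl : IsControllable A.mulVecLin ((1 + A.mulVecLin : Module.End ℝ (n → ℝ)) ∘ₗ N.mulVecLin))
    (hobs : IsObservable A.mulVecLin C.mulVecLin)
    (hs : ∀ u T, 0 ≤ suppliedEnergy A.mulVecLin ((1 + A.mulVecLin) ∘ₗ N.mulVecLin)
      (cayleySupply (toLinearMap₂' ℝ C) N.mulVecLin) u T) :
    ∃ X : Matrix n n ℝ, X.IsSymm ∧ X.PosDef ∧ (X - Aᵀ * X * A).PosSemidef ∧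
      C = Nᵀ * X * (A + 1) := by
  obtain ⟨Q, hQ0, hQ⟩ := hctrl.exists_storage hs
  obtain ⟨X, hsymm, hX⟩ := exists_isSymm_dotProduct_mulVec_eq_polar Q
  have hself : ∀ x, x ⬝ᵥ X *ᵥ x = 2 * Q x := fun x => by
    rw [hX, QuadraticMap.polar_self, nsmul_eq_mul, Nat.cast_ofNat]
  have hpsd : X.PosSemidef := .of_dotProduct_mulVec_nonneg hsymm fun x => by
    rw [star_trivial, hself]
    exact mul_nonneg zero_le_two (hQ0 x)
  have hdecr : (X - Aᵀ * X * A).PosSemidef := by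
    refine .of_dotProduct_mulVec_nonneg ?_ fun x => ?_
    · exact hpsd.1.sub (isHermitian_conjTranspose_mul_mul A hpsd.1)
    · have h := hQ x 0
      rw [map_zero, add_zero, cayleySupply_apply, map_zero, LinearMap.zero_apply, add_zero] at h
      rw [star_trivial, sub_mulVec, dotProduct_sub, ← mulVec_mulVec, ← mulVec_mulVec,
        dotProduct_mulVec x Aᵀ, vecMul_transpose, hself, hself, sub_nonneg]
      exact mul_le_mul_of_nonneg_left h zero_le_two
  have hCX : C = Nᵀ * X * (A + 1) := by
    have hform : (toLinearMap₂' ℝ C : (m → ℝ) →ₗ[ℝ] (n → ℝ) →ₗ[ℝ] ℝ) =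
        toLinearMap₂' ℝ (Nᵀ * X * (A + 1)) := by
      refine LinearMap.ext₂ fun u w => ?_
      rw [eq_polar_of_cayleySupply hQ, ← hX, toLinearMap₂'_apply', ← mulVec_mulVec,
        ← mulVec_mulVec, dotProduct_mulVec u, vecMul_transpose, add_mulVec, one_mulVec]
      rfl
    simpa only [LinearMap.toMatrix'_toLinearMap₂'] using congrArg (LinearMap.toMatrix₂' ℝ) hform
  refine ⟨X, hsymm, posDef_of_isObservable hpsd hdecr (fun w hAw hw => ?_) hobs, hdecr, hCX⟩
  rw [hCX, ← mulVec_mulVec, ← mulVec_mulVec, add_mulVec, one_mulVec, mulVec_add, hAw, hw,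
    add_zero, mulVec_zero]

end Lyapunov

section CircleAverages

open Real

theorem circleAverage_zpow (l : ℤ) :
    circleAverage (fun w : ℂ => w ^ l) 0 1 = if l = 0 then 1 else 0 := by
  split_ifs with hl
  · simp only [hl, zpow_zero]
    exact circleAverage_const _ _ _
  · have hcongr : (∮ w in C(0, 1), (w - 0)⁻¹ • w ^ l) = ∮ w in C(0, 1), (w - 0) ^ (l - 1) :=
      circleIntegral.integral_congr zero_le_one fun w hw => by
        have hw0 : w ≠ 0 := ne_zero_of_mem_unit_sphere ⟨w, hw⟩
        simp only [sub_zero, smul_eq_mul, zpow_sub_one₀ hw0, mul_comm]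
    rw [circleAverage_eq_circleIntegral one_ne_zero, hcongr,
      circleIntegral.integral_sub_zpow_of_ne (by lia), smul_zero]

theorem circleAverage_pow_mul {h : ℂ → ℂ} (hh : ∀ w : ℂ, ‖w‖ ≤ 1 → DifferentiableAt ℂ h w) {d : ℕ}
    (hd : d ≠ 0) : circleAverage (fun w => w ^ d * h w) 0 1 = 0 := by
  have hdiff : DiffContOnCl ℂ (fun w => w ^ d * h w) (Metric.ball 0 |1|) := by
    refine DifferentiableOn.diffContOnCl fun w hw => ?_
    rw [abs_one, closure_ball _ one_ne_zero, mem_closedBall_zero_iff] at hw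
    exact ((differentiableAt_id.pow d).mul (hh w hw)).differentiableWithinAt
  rw [hdiff.circleAverage, zero_pow hd, zero_mul]

theorem circleIntegrable_zpow_mul {h : ℂ → ℂ} (hh : ∀ w : ℂ, ‖w‖ = 1 → ContinuousAt h w) (l : ℤ) :
    CircleIntegrable (fun w => w ^ l * h w) 0 1 :=
  ContinuousOn.circleIntegrable zero_le_one fun w hw =>
    ((continuousAt_zpow₀ w l (.inl (ne_zero_of_mem_unit_sphere ⟨w, hw⟩))).mul
      (hh w (mem_sphere_zero_iff_norm.mp hw))).continuousWithinAt

/-- Averaging against `w ^ (-k)` extracts the `k`-th Taylor coefficient. -/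
theorem circleAverage_zpow_neg_mul {h : ℂ → ℂ} (hh : ∀ w : ℂ, ‖w‖ ≤ 1 → DifferentiableAt ℂ h w)
    (a : ℕ → ℂ) {k T : ℕ} (hk : k < T) :
    circleAverage
      (fun w => w ^ (-k : ℤ) * (∑ j ∈ Finset.range T, w ^ j * a j + w ^ T * h w)) 0 1 = a k := by
  have hexpand : Set.EqOn
      (fun w => w ^ (-k : ℤ) * (∑ j ∈ Finset.range T, w ^ j * a j + w ^ T * h w))
      (fun w => ∑ j ∈ Finset.range T, a j • w ^ (j - k : ℤ) + w ^ (T - k) * h w)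
      (Metric.sphere 0 |1|) := fun w hw => by
    have hw0 : w ≠ 0 := ne_zero_of_mem_unit_sphere ⟨w, abs_one (α := ℝ) ▸ hw⟩
    have hpow : ∀ j : ℕ, w ^ (-k : ℤ) * w ^ j = w ^ (j - k : ℤ) := fun j => by
      rw [← zpow_natCast, ← zpow_add₀ hw0, neg_add_eq_sub]
    simp only [mul_add, Finset.mul_sum, ← mul_assoc, hpow, smul_eq_mul, mul_comm (a _)]
    rw [← Nat.cast_sub hk.le, zpow_natCast]
  have hterm : ∀ j, CircleIntegrable (fun w => a j • w ^ (j - k : ℤ)) 0 1 := fun j => by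
    simpa only [smul_eq_mul, mul_comm (a j)] using
      circleIntegrable_zpow_mul (h := fun _ => a j) (fun _ _ => continuousAt_const) (j - k)
  have hrem : CircleIntegrable (fun w => w ^ (T - k) * h w) 0 1 := by
    simpa only [zpow_natCast] using
      circleIntegrable_zpow_mul (fun w hw => (hh w hw.le).continuousAt) ((T - k : ℕ) : ℤ)
  rw [circleAverage_congr_sphere hexpand,
    circleAverage_fun_add (CircleIntegrable.fun_sum _ fun j _ => hterm j) hrem,
    circleAverage_fun_sum fun j _ => hterm j,
    circleAverage_pow_mul hh (Nat.sub_pos_of_lt hk).ne', add_zero]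
  have havg : ∀ j : ℕ, circleAverage (fun w => a j • w ^ (j - k : ℤ)) 0 1 =
      if j = k then a j else 0 := fun j => by
    rw [circleAverage_fun_smul, circleAverage_zpow]
    simp only [sub_eq_zero, Nat.cast_inj, smul_eq_mul, mul_ite, mul_one, mul_zero]
  rw [Finset.sum_congr rfl fun j _ => havg j, Finset.sum_ite_eq', if_pos (Finset.mem_range.mpr hk)]

theorem circleAverage_nonneg_of_eventually_cofinite {f : ℂ → ℝ}
    (hf : ∀ᶠ w in cofinite, ‖w‖ = 1 → 0 ≤ f w) : 0 ≤ circleAverage f 0 1 := by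
  have hcongr : f =ᶠ[codiscreteWithin (Metric.sphere (0 : ℂ) |1|)] fun w => max 0 (f w) := by
    rw [(isCompact_sphere _ _).codiscreteWithin_eq, EventuallyEq, eventually_inf_principal]
    filter_upwards [hf] with w hw hsphere
    rw [abs_one, mem_sphere_zero_iff_norm] at hsphere
    exact (max_eq_right (hw hsphere)).symm
  rw [circleAverage_congr_codiscreteWithin hcongr one_ne_zero]
  exact circleAverage_nonneg_of_nonneg fun w _ => le_max_left _ _

end CircleAverages

section Passivity

variable {m n : Type*} [Fintype m] [Fintype n] [DecidableEq n]

/-- Parseval's identity for a causal output: its terms of order at least `T` are orthogonal to the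
truncated input. -/
theorem re_sum_star_dotProduct_nonneg {u y : ℕ → m → ℂ} {T : ℕ} {h : ℂ → m → ℂ}
    (hh : ∀ w : ℂ, ‖w‖ ≤ 1 → DifferentiableAt ℂ h w)
    (hre : ∀ᶠ w : ℂ in cofinite, ‖w‖ = 1 → 0 ≤ (star (∑ k ∈ Finset.range T, w ^ k • u k) ⬝ᵥ
      (∑ k ∈ Finset.range T, w ^ k • y k + w ^ T • h w)).re) :
    0 ≤ (∑ k ∈ Finset.range T, star (u k) ⬝ᵥ y k).re := by
  let F : ℕ → ℂ → ℂ := fun k w => w ^ (-k : ℤ) *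
    (∑ j ∈ Finset.range T, w ^ j * (star (u k) ⬝ᵥ y j) + w ^ T * (star (u k) ⬝ᵥ h w))
  have hdiff : ∀ k, ∀ w : ℂ, ‖w‖ ≤ 1 → DifferentiableAt ℂ (fun w => star (u k) ⬝ᵥ h w) w :=
    fun k w hw => DifferentiableAt.fun_sum fun i _ =>
      (differentiableAt_const _).mul (differentiableAt_pi.mp (hh w hw) i)
  have hint : ∀ k, CircleIntegrable (F k) 0 1 := fun k =>
    circleIntegrable_zpow_mul (fun w hw => by
      have hcont := (hdiff k w hw.le).continuousAt
      fun_prop) (-k)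
  have hF : ∀ w : ℂ, ‖w‖ = 1 → star (∑ k ∈ Finset.range T, w ^ k • u k) ⬝ᵥ
      (∑ k ∈ Finset.range T, w ^ k • y k + w ^ T • h w) = ∑ k ∈ Finset.range T, F k w := by
    intro w hw
    have hstar : ∀ k : ℕ, star (w ^ k) = w ^ (-k : ℤ) := fun k => by
      rw [star_pow, ← starRingEnd_apply, ← Complex.inv_eq_conj hw, inv_pow, _root_.zpow_neg,
        zpow_natCast]
    rw [star_sum, sum_dotProduct]
    refine Finset.sum_congr rfl fun k _ => ?_
    rw [star_smul, smul_dotProduct, hstar, smul_eq_mul, dotProduct_add, dotProduct_sum]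
    simp only [dotProduct_smul, smul_eq_mul, F]
  have havg : Real.circleAverage (fun w => ∑ k ∈ Finset.range T, F k w) 0 1 =
      ∑ k ∈ Finset.range T, star (u k) ⬝ᵥ y k := by
    rw [Real.circleAverage_fun_sum fun k _ => hint k]
    exact Finset.sum_congr rfl fun k hk =>
      circleAverage_zpow_neg_mul (hdiff k) _ (Finset.mem_range.mp hk)
  rw [← havg, ← Complex.reCLM_apply,
    ← Complex.reCLM.circleAverage_comp_comm (CircleIntegrable.fun_sum _ fun k _ => hint k)]
  refine circleAverage_nonneg_of_eventually_cofinite ?_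
  filter_upwards [hre] with w hw hnorm
  exact (hw hnorm).trans_eq (congrArg Complex.re (hF w hnorm))

theorem resolvent_mulVec_sum_trajectory {K : Type*} [Field K] {A : Matrix n n K}
    {B : Matrix n m K} {x : ℕ → n → K} {u : ℕ → m → K} (hx0 : x 0 = 0)
    (hx : ∀ k, x (k + 1) = A *ᵥ x k + B *ᵥ u k) {w : K} (hw : w ≠ 0) (T : ℕ) :
    (w⁻¹ • (1 : Matrix n n K) - A) *ᵥ (∑ k ∈ Finset.range T, w ^ k • x k) + w ^ T • w⁻¹ • x T =
      B *ᵥ ∑ k ∈ Finset.range T, w ^ k • u k := by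
  induction T with
  | zero => simp only [Finset.sum_range_zero, mulVec_zero, hx0, smul_zero, add_zero]
  | succ T ih =>
    rw [Finset.sum_range_succ, Finset.sum_range_succ, mulVec_add, mulVec_add, ← ih, hx, pow_succ,
      mul_smul, smul_inv_smul₀ hw, sub_mulVec _ _ (w ^ T • x T), smul_mulVec, one_mulVec,
      mulVec_smul, mulVec_smul, smul_comm w⁻¹]
    module

/-- The `z`-transform of the output, at `z = w⁻¹`; the last summand is the free response of the
state reached at time `T`. -/
theorem transferMatrix_mulVec_sum {K : Type*} [Field K] {A : Matrix n n K} {B : Matrix n m K}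
    (C : Matrix m n K) (J : Matrix m m K) {x : ℕ → n → K} {u : ℕ → m → K} (hx0 : x 0 = 0)
    (hx : ∀ k, x (k + 1) = A *ᵥ x k + B *ᵥ u k) {w : K} (hw : w ≠ 0)
    (hdet : (1 - w • A).det ≠ 0) (T : ℕ) :
    transferMatrix A B C J w⁻¹ *ᵥ (∑ k ∈ Finset.range T, w ^ k • u k) =
      ∑ k ∈ Finset.range T, w ^ k • (C *ᵥ x k + J *ᵥ u k) +
        w ^ T • (C *ᵥ ((1 - w • A)⁻¹ *ᵥ x T)) := by
  set e := (1 - w • A)⁻¹ *ᵥ x T with he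
  have hR : w⁻¹ • (1 : Matrix n n K) - A = w⁻¹ • (1 - w • A) := by
    rw [smul_sub, inv_smul_smul₀ hw]
  have hRdet : IsUnit (w⁻¹ • (1 : Matrix n n K) - A).det := by
    rw [hR, det_smul]
    exact (mul_ne_zero (pow_ne_zero _ (inv_ne_zero hw)) hdet).isUnit
  have hRe : (w⁻¹ • (1 : Matrix n n K) - A) *ᵥ e = w⁻¹ • x T := by
    rw [hR, he, smul_mulVec, mulVec_mulVec, mul_nonsing_inv _ hdet.isUnit, one_mulVec]
  have hstate : (w⁻¹ • (1 : Matrix n n K) - A)⁻¹ *ᵥ (B *ᵥ ∑ k ∈ Finset.range T, w ^ k • u k) =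
      ∑ k ∈ Finset.range T, w ^ k • x k + w ^ T • e := by
    rw [← resolvent_mulVec_sum_trajectory hx0 hx hw, ← hRe, ← mulVec_smul, ← mulVec_add,
      mulVec_mulVec, nonsing_inv_mul _ hRdet, one_mulVec]
  rw [transferMatrix, add_mulVec, ← mulVec_mulVec, ← mulVec_mulVec, hstate, mulVec_add,
    mulVec_smul, mulVec_sum, mulVec_sum, add_right_comm, ← Finset.sum_add_distrib]
  simp only [mulVec_smul, smul_add]

theorem sum_dotProduct_output_nonneg {A : Matrix n n ℝ} {B : Matrix n m ℝ} {C : Matrix m n ℝ}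
    {J : Matrix m m ℝ} (hstab : ∀ w : ℂ, ‖w‖ ≤ 1 → (1 - w • A.map ι).det ≠ 0)
    (hre : ∀ᶠ z in cofinite, ‖z‖ = 1 → ∀ v, 0 ≤ (star v ⬝ᵥ
      transferMatrix (A.map ι) (B.map ι) (C.map ι) (J.map ι) z *ᵥ v).re)
    (u : ℕ → m → ℝ) (T : ℕ) :
    0 ≤ ∑ k ∈ Finset.range T,
      u k ⬝ᵥ (C *ᵥ stateTrajectory A.mulVecLin B.mulVecLin u k + J *ᵥ u k) := by
  set x := stateTrajectory A.mulVecLin B.mulVecLin u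
  have hx0 : ι ∘ x 0 = 0 := funext fun _ => map_zero ι
  have hxs : ∀ k, ι ∘ x (k + 1) = A.map ι *ᵥ (ι ∘ x k) + B.map ι *ᵥ (ι ∘ u k) := fun k => by
    rw [← comp_mulVec, ← comp_mulVec]
    exact funext fun _ => map_add ι _ _
  have hdiff : ∀ w : ℂ, ‖w‖ ≤ 1 → DifferentiableAt ℂ
      (fun w => C.map ι *ᵥ ((1 - w • A.map ι)⁻¹ *ᵥ (ι ∘ x T))) w := fun w hw => by
    have hentry : ∀ i j, AnalyticAt ℂ (fun w : ℂ => (1 - w • A.map ι) i j) w := fun i j => by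
      simp only [Matrix.sub_apply, Matrix.smul_apply]
      fun_prop
    have hinv := fun i j => (analyticAt_nonsing_inv_apply hentry (hstab w hw) i j).differentiableAt
    refine differentiableAt_pi.mpr fun i => ?_
    simp only [mulVec, dotProduct]
    exact DifferentiableAt.fun_sum fun j _ =>
      (DifferentiableAt.fun_sum fun k _ => (hinv j k).mul_const _).const_mul _
  have hreal : ∀ k, star (ι ∘ u k) ⬝ᵥ (C.map ι *ᵥ (ι ∘ x k) + J.map ι *ᵥ (ι ∘ u k)) =
      ι (u k ⬝ᵥ (C *ᵥ x k + J *ᵥ u k)) := fun k => by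
    have hstar : star (ι ∘ u k) = ι ∘ u k := funext fun i => Complex.conj_ofReal (u k i)
    rw [hstar, ← comp_mulVec, ← comp_mulVec, RingHom.map_dotProduct ι]
    exact congrArg _ (funext fun _ => (map_add ι _ _).symm)
  have h := re_sum_star_dotProduct_nonneg hdiff (u := fun k => ι ∘ u k)
    (y := fun k => C.map ι *ᵥ (ι ∘ x k) + J.map ι *ᵥ (ι ∘ u k)) (T := T) ?_
  · simp only [hreal, ← map_sum] at h
    exact h
  · filter_upwards [inv_injective.tendsto_cofinite hre, eventually_cofinite_ne 0]
      with w hw hw0 hnorm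
    rw [← transferMatrix_mulVec_sum _ _ hx0 hxs hw0 (hstab w hnorm.le)]
    exact hw (by rw [norm_inv, hnorm, inv_one]) _

end Passivity

section NegImag

variable {m : ℕ} {F F' : ℂ → Matrix (Fin m) (Fin m) ℂ}

theorem star_dotProduct_I_smul_sub_conjTranspose_mulVec {m : Type*} [Fintype m] (M : Matrix m m ℂ)
    (v : m → ℂ) :
    star v ⬝ᵥ (Complex.I • (M - Mᴴ)) *ᵥ v = ((-2 * (star v ⬝ᵥ M *ᵥ v).im : ℝ) : ℂ) := by
  have hconj : star v ⬝ᵥ Mᴴ *ᵥ v = star (star v ⬝ᵥ M *ᵥ v) := by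
    rw [← star_dotProduct, star_mulVec, ← dotProduct_mulVec]
  rw [smul_mulVec, sub_mulVec, dotProduct_smul, dotProduct_sub, hconj, smul_eq_mul,
    Complex.star_def, Complex.sub_conj]
  push_cast
  linear_combination (2 * ((star v ⬝ᵥ M *ᵥ v).im : ℂ)) * Complex.I_mul_I

theorem IsDiscreteNegImag.congr (hF : IsDiscreteNegImag F) (h : Set.EqOn F F' {z | 1 < ‖z‖}) :
    IsDiscreteNegImag F' where
  analytic i j := (hF.analytic i j).congr (isOpen_lt continuous_const continuous_norm)
    fun _ hz => congrArg (fun M : Matrix (Fin m) (Fin m) ℂ => M i j) (h hz)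
  upper z hz := h hz ▸ hF.upper z hz
  real_axis z hz := h hz ▸ hF.real_axis z hz
  lower z hz := h hz ▸ hF.lower z hz

theorem IsDiscreteNegImag.isHermitian (hF : IsDiscreteNegImag F) {z : ℂ} (hz : 1 < ‖z‖)
    (him : z.im = 0) : (F z).IsHermitian :=
  (sub_eq_zero.mp ((smul_eq_zero.mp (hF.real_axis z hz him)).resolve_left Complex.I_ne_zero)).symm

theorem IsDiscreteNegImag.im_mul_im_nonpos (hF : IsDiscreteNegImag F) {z : ℂ} (hz : 1 < ‖z‖)
    (v : Fin m → ℂ) : z.im * (star v ⬝ᵥ F z *ᵥ v).im ≤ 0 := by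
  rcases lt_trichotomy z.im 0 with him | him | him
  · have h := (hF.lower z hz him).dotProduct_mulVec_nonneg v
    rw [neg_mulVec, dotProduct_neg, star_dotProduct_I_smul_sub_conjTranspose_mulVec,
      ← Complex.ofReal_neg, Complex.zero_le_real] at h
    exact mul_nonpos_of_nonpos_of_nonneg him.le (by linarith)
  · rw [him, zero_mul]
  · have h := (hF.upper z hz him).dotProduct_mulVec_nonneg v
    rw [star_dotProduct_I_smul_sub_conjTranspose_mulVec, Complex.zero_le_real] at h
    exact mul_nonpos_of_nonneg_of_nonpos him.le (by linarith)

end NegImag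

section Necessity

theorem det_one_sub_smul_ne_zero {K n : Type*} [NormedField K] [Fintype n] [DecidableEq n]
    {A : Matrix n n K} (hA : ∀ z : K, 1 < ‖z‖ → (z • (1 : Matrix n n K) - A).det ≠ 0) {w : K}
    (hw : ‖w‖ < 1) : (1 - w • A).det ≠ 0 := by
  rcases eq_or_ne w 0 with rfl | hw0
  · simp only [zero_smul, sub_zero, det_one, ne_eq, one_ne_zero, not_false_eq_true]
  · have hfactor : 1 - w • A = w • (w⁻¹ • (1 : Matrix n n K) - A) := by
      rw [smul_sub, smul_inv_smul₀ hw0]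
    rw [hfactor, det_smul]
    refine mul_ne_zero (pow_ne_zero _ hw0) (hA _ ?_)
    rwa [norm_inv, one_lt_inv₀ (norm_pos_iff.mpr hw0)]

/-- On the unit circle `(z + 1) / (z - 1)` is purely imaginary, with the sign of `-z.im`. -/
theorem re_nonneg_of_sub_one_mul_eq {z p g₁ g₂ : ℂ} (hz : ‖z‖ = 1) (hz1 : z ≠ 1)
    (h : (z - 1) * p = (z + 1) * (g₁ - g₂)) (h₁ : g₁.im = 0) (h₂ : z.im * g₂.im ≤ 0) :
    0 ≤ p.re := by
  have hpos : 0 < Complex.normSq (z - 1) := Complex.normSq_pos.mpr (sub_ne_zero.mpr hz1)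
  have hunit : z * star z = 1 := by
    rw [Complex.star_def, Complex.mul_conj, Complex.normSq_eq_norm_sq, hz, one_pow,
      Complex.ofReal_one]
  have hmul : (Complex.normSq (z - 1) : ℂ) * p = (star z - z) * (g₁ - g₂) := by
    rw [← Complex.mul_conj, map_sub, map_one, ← Complex.star_def]
    linear_combination (star z - 1) * h + (g₁ - g₂) * hunit
  have hre := congrArg Complex.re hmul
  rw [Complex.re_ofReal_mul, Complex.mul_re] at hre
  simp only [Complex.star_def, Complex.sub_re, Complex.sub_im, Complex.conj_re, Complex.conj_im,
    sub_self, h₁] at hre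
  refine nonneg_of_mul_nonneg_right ?_ hpos
  linarith

variable {m : ℕ} {n : Type*} [Fintype n] [DecidableEq n]

/-- Evaluating at `t⁻¹ z` with `t < 1` moves the unit circle into the domain of analyticity. -/
theorem IsDiscreteNegImag.re_transferMatrix_cayley_nonneg {A : Matrix n n ℂ}
    {B N : Matrix n (Fin m) ℂ} {C : Matrix (Fin m) n ℂ} {D : Matrix (Fin m) (Fin m) ℂ}
    (hF : IsDiscreteNegImag (transferMatrix A B C D))
    (hA : ∀ z : ℂ, 1 < ‖z‖ → (z • (1 : Matrix n n ℂ) - A).det ≠ 0) {t : ℝ} (ht0 : 0 < t)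
    (ht1 : t < 1) (hN : (1 - (t : ℂ) • A) * N = (t : ℂ) • B) {z : ℂ} (hz : ‖z‖ = 1) (hz1 : z ≠ 1)
    (v : Fin m → ℂ) :
    0 ≤ (star v ⬝ᵥ
      transferMatrix ((t : ℂ) • A) ((1 + (t : ℂ) • A) * N) C (C * N) z *ᵥ v).re := by
  have htc : (t : ℂ) ≠ 0 := Complex.ofReal_ne_zero.mpr ht0.ne'
  have hnorm : ∀ ζ : ℂ, ‖ζ‖ = 1 → 1 < ‖(t : ℂ)⁻¹ * ζ‖ := fun ζ hζ => by
    rw [norm_mul, hζ, mul_one, norm_inv, Complex.norm_real, Real.norm_of_nonneg ht0.le]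
    exact (one_lt_inv₀ ht0).mpr ht1
  have hdet : ∀ ζ : ℂ, ‖ζ‖ = 1 → (ζ • (1 : Matrix n n ℂ) - (t : ℂ) • A).det ≠ 0 := fun ζ hζ => by
    rw [← smul_inv_smul₀ htc (ζ • (1 : Matrix n n ℂ)), ← smul_sub, smul_smul, det_smul]
    exact mul_ne_zero (pow_ne_zero _ htc) (hA _ (hnorm ζ hζ))
  have hcayley := transferMatrix_cayley (C := C) (D := D) hN
    (by simpa only [one_smul] using hdet 1 norm_one) (hdet z hz)
  rw [transferMatrix_smul htc, transferMatrix_smul htc] at hcayley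
  refine re_nonneg_of_sub_one_mul_eq hz hz1
    (g₁ := star v ⬝ᵥ transferMatrix A B C D ((t : ℂ)⁻¹ * 1) *ᵥ v)
    (g₂ := star v ⬝ᵥ transferMatrix A B C D ((t : ℂ)⁻¹ * z) *ᵥ v) ?_ ?_ ?_
  · rw [← dotProduct_sub, ← sub_mulVec, ← smul_eq_mul, ← smul_eq_mul, ← dotProduct_smul,
      ← dotProduct_smul, ← smul_mulVec, ← smul_mulVec, hcayley]
  · refine (hF.isHermitian (hnorm 1 norm_one) ?_).im_star_dotProduct_mulVec_self v
    rw [mul_one, ← Complex.ofReal_inv, Complex.ofReal_im]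
  · have h := hF.im_mul_im_nonpos (hnorm z hz) v
    have him : ((t : ℂ)⁻¹ * z).im = t⁻¹ * z.im := by
      rw [← Complex.ofReal_inv, Complex.im_ofReal_mul]
    rw [him, mul_assoc] at h
    exact nonpos_of_mul_nonpos_right h (inv_pos.mpr ht0)

variable {A : Matrix n n ℝ} {B N : Matrix n (Fin m) ℝ} {C : Matrix (Fin m) n ℝ}
  {D : Matrix (Fin m) (Fin m) ℝ}

theorem mulVecLin_one_add_mul {R m n : Type*} [CommRing R] [Fintype m] [Fintype n] [DecidableEq n]
    (A : Matrix n n R) (N : Matrix n m R) :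
    ((1 + A) * N).mulVecLin = (1 + A.mulVecLin : Module.End R (n → R)) ∘ₗ N.mulVecLin := by
  rw [mulVecLin_mul, mulVecLin_add, mulVecLin_one]
  rfl

theorem IsDiscreteNegImag.suppliedEnergy_smul_nonneg
    (hF : IsDiscreteNegImag (transferMatrix (A.map ι) (B.map ι) (C.map ι) (D.map ι)))
    (hA : ∀ z : ℂ, 1 < ‖z‖ → (z • (1 : Matrix n n ℂ) - A.map ι).det ≠ 0) {t : ℝ} (ht0 : 0 < t)
    (ht1 : t < 1) (hN : (1 - t • A) * N = t • B) (u : ℕ → Fin m → ℝ) (T : ℕ) :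
    0 ≤ suppliedEnergy (t • A).mulVecLin ((1 + t • A) * N).mulVecLin
      (cayleySupply (toLinearMap₂' ℝ C) N.mulVecLin) u T := by
  have hone : (1 : Matrix n n ℝ).map ι = 1 := Matrix.map_one ι (map_zero ι) (map_one ι)
  have hsmul : (t • A).map ι = (t : ℂ) • A.map ι := Matrix.map_smul' _ _ _ (map_mul ι)
  have hN' : (1 - (t : ℂ) • A.map ι) * N.map ι = (t : ℂ) • B.map ι := by
    have h := congrArg (fun M : Matrix n (Fin m) ℝ => M.map ι) hN
    simp only [Matrix.map_mul, Matrix.map_sub ι (map_sub ι), hone, hsmul] at h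
    exact h.trans (Matrix.ext fun _ _ => map_mul ι _ _)
  have hstab : ∀ w : ℂ, ‖w‖ ≤ 1 → (1 - w • (t • A).map ι).det ≠ 0 := fun w hw => by
    rw [hsmul, smul_smul]
    refine det_one_sub_smul_ne_zero hA ?_
    rw [norm_mul, Complex.norm_real, Real.norm_of_nonneg ht0.le]
    exact (mul_le_of_le_one_left ht0.le hw).trans_lt ht1
  have h := sum_dotProduct_output_nonneg (B := (1 + t • A) * N) (C := C) (J := C * N) hstab ?_ u T
  · simpa only [suppliedEnergy, cayleySupply_apply, toLinearMap₂'_apply', mulVecLin_apply,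
      mulVec_add, mulVec_mulVec] using h
  · filter_upwards [eventually_cofinite_ne 1] with z hz1 hz v
    rw [Matrix.map_mul, Matrix.map_mul, Matrix.map_add ι (map_add ι), hone, hsmul]
    exact hF.re_transferMatrix_cayley_nonneg hA ht0 ht1 hN' hz hz1 v

theorem continuousAt_nonsing_inv_one_sub_smul {t : ℝ} (ht : (1 - t • A).det ≠ 0) :
    ContinuousAt (fun t : ℝ => (1 - t • A)⁻¹) t := by
  have hcont : ContinuousAt (fun t : ℝ => 1 - t • A) t := by fun_prop
  refine ContinuousAt.comp (g := Inv.inv) (continuousAt_matrix_inv _ ?_) hcont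
  rw [Ring.inverse_eq_inv']
  exact continuousAt_inv₀ ht

theorem continuous_suppliedEnergy_cayleySupply {m : Type*} [Fintype m] [DecidableEq m]
    (C : Matrix m n ℝ) (u : ℕ → m → ℝ) (T : ℕ) :
    Continuous fun p : Matrix n n ℝ × Matrix n m ℝ =>
      suppliedEnergy p.1.mulVecLin ((1 + p.1) * p.2).mulVecLin
        (cayleySupply (toLinearMap₂' ℝ C) p.2.mulVecLin) u T := by
  have hx : ∀ k, Continuous fun p : Matrix n n ℝ × Matrix n m ℝ =>
      stateTrajectory p.1.mulVecLin ((1 + p.1) * p.2).mulVecLin u k := fun k => by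
    induction k with
    | zero => exact continuous_const
    | succ k ih =>
      simp only [stateTrajectory, mulVecLin_apply]
      fun_prop
  simp only [suppliedEnergy, cayleySupply_apply, toLinearMap₂'_apply', mulVecLin_apply]
  fun_prop

theorem IsDiscreteNegImag.suppliedEnergy_nonneg
    (hF : IsDiscreteNegImag (transferMatrix (A.map ι) (B.map ι) (C.map ι) (D.map ι)))
    (hA : ∀ z : ℂ, 1 < ‖z‖ → (z • (1 : Matrix n n ℂ) - A.map ι).det ≠ 0)
    (hN : (1 - A) * N = B) (hminus : (1 - A).det ≠ 0) (u : ℕ → Fin m → ℝ) (T : ℕ) :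
    0 ≤ suppliedEnergy A.mulVecLin ((1 + A) * N).mulVecLin
      (cayleySupply (toLinearMap₂' ℝ C) N.mulVecLin) u T := by
  let system : ℝ → Matrix n n ℝ × Matrix n (Fin m) ℝ := fun t => (t • A, (1 - t • A)⁻¹ * t • B)
  have hlim : system 1 = (A, N) := by
    simp only [system, one_smul, ← hN, nonsing_inv_mul_cancel_left _ _ hminus.isUnit]
  have hinv := continuousAt_nonsing_inv_one_sub_smul (t := 1) (by rwa [one_smul])
  have hcont : ContinuousAt system 1 := by
    have hmul : Continuous fun p : ℝ × Matrix n n ℝ => (p.1 • A, p.2 * p.1 • B) := by fun_prop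
    exact hmul.continuousAt.comp (f := fun t : ℝ => (t, (1 - t • A)⁻¹))
      (continuousAt_id.prodMk hinv)
  have henergy := (continuous_suppliedEnergy_cayleySupply C u T).continuousAt.comp hcont
  have hnear := henergy.tendsto.mono_left (nhdsWithin_le_nhds (s := Set.Iio 1))
  rw [Function.comp_apply, hlim] at hnear
  have hdet : ∀ᶠ t : ℝ in 𝓝[<] 1, (1 - t • A).det ≠ 0 := by
    have hcont : ContinuousAt (fun t : ℝ => (1 - t • A).det) 1 := by fun_prop
    exact nhdsWithin_le_nhds (hcont.eventually_ne (by rwa [one_smul]))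
  refine ge_of_tendsto hnear ?_
  filter_upwards [Ioo_mem_nhdsLT (zero_lt_one' ℝ), hdet] with t ht hdet
  exact hF.suppliedEnergy_smul_nonneg hA ht.1 ht.2
    (mul_nonsing_inv_cancel_left _ _ hdet.isUnit) u T

theorem IsDiscreteNegImag.feedthrough_isSymm
    (hF : IsDiscreteNegImag (transferMatrix (A.map ι) (B.map ι) (C.map ι) (D.map ι))) :
    D.IsSymm := by
  have hsymm : ∀ t : ℝ, 0 < t → t < 1 → (transferMatrix (t • A) (t • B) C D 1).IsSymm := by
    intro t ht0 ht1
    have h := hF.isHermitian (z := ι (t⁻¹ * 1)) ?_ (Complex.ofReal_im _)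
    · rw [← map_transferMatrix] at h
      rw [transferMatrix_smul ht0.ne']
      exact .ext fun i j =>
        Complex.ofReal_injective ((Complex.conj_ofReal _).symm.trans (h.apply i j))
    · rw [mul_one, Complex.coe_algebraMap, Complex.norm_real,
        Real.norm_of_nonneg (inv_pos.mpr ht0).le]
      exact (one_lt_inv₀ ht0).mpr ht1
  have hinv := continuousAt_nonsing_inv_one_sub_smul (A := A) (t := 0) (by simp)
  have hcont : ContinuousAt (fun t : ℝ => transferMatrix (t • A) (t • B) C D 1) 0 := by
    have hmul : Continuous fun p : ℝ × Matrix n n ℝ => C * p.2 * p.1 • B + D := by fun_prop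
    simp only [transferMatrix, one_smul]
    exact hmul.continuousAt.comp (f := fun t : ℝ => (t, (1 - t • A)⁻¹))
      (continuousAt_id.prodMk hinv)
  have hnear := hcont.tendsto.mono_left (nhdsWithin_le_nhds (s := Set.Ioi 0))
  simp only [transferMatrix, zero_smul, Matrix.mul_zero, zero_add] at hnear
  have hclosed : IsClosed {M : Matrix (Fin m) (Fin m) ℝ | Mᵀ = M} :=
    isClosed_eq continuous_id.matrix_transpose continuous_id
  refine hclosed.mem_of_tendsto hnear ?_
  filter_upwards [Ioo_mem_nhdsGT (zero_lt_one' ℝ)] with t ht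
  exact hsymm t ht.1 ht.2

theorem IsMinimalRealization.det_resolvent_ne_zero_of_isDiscreteNegImag {m n : ℕ}
    {G : Matrix (Fin m) (Fin m) (RatFunc ℝ)} {A : Matrix (Fin n) (Fin n) ℝ}
    {B : Matrix (Fin n) (Fin m) ℝ} {C : Matrix (Fin m) (Fin n) ℝ} {D : Matrix (Fin m) (Fin m) ℝ}
    (h : IsMinimalRealization G A B C D) (hF : IsDiscreteNegImag (transferEval G)) {z : ℂ}
    (hz : 1 < ‖z‖) : (z • (1 : Matrix (Fin n) (Fin n) ℂ) - A.map ι).det ≠ 0 :=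
  h.det_resolvent_ne_zero (continuousAt_pi.mpr fun i => continuousAt_pi.mpr fun j =>
    (hF.analytic i j z hz).continuousAt)

theorem IsMinimalRealization.negImagStateSpaceCondition {m n : ℕ}
    {G : Matrix (Fin m) (Fin m) (RatFunc ℝ)} {A : Matrix (Fin n) (Fin n) ℝ}
    {B : Matrix (Fin n) (Fin m) ℝ} {C : Matrix (Fin m) (Fin n) ℝ} {D : Matrix (Fin m) (Fin m) ℝ}
    (h : IsMinimalRealization G A B C D) (hplus : (1 + A).det ≠ 0) (hminus : (1 - A).det ≠ 0)
    (hG : IsDiscreteNegImag (transferEval G)) : NegImagStateSpaceCondition A B C D := by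
  have hA : ∀ z : ℂ, 1 < ‖z‖ → (z • (1 : Matrix (Fin n) (Fin n) ℂ) - A.map ι).det ≠ 0 :=
    fun _ hz => h.det_resolvent_ne_zero_of_isDiscreteNegImag hG hz
  have hF := hG.congr fun z hz => h.1.transferEval_eq (hA z hz)
  set N := (1 - A)⁻¹ * B
  have hN : (1 - A) * N = B := mul_nonsing_inv_cancel_left _ _ hminus.isUnit
  have hctrl : IsControllable A.mulVecLin
      ((1 + A.mulVecLin : Module.End ℝ (Fin n → ℝ)) ∘ₗ N.mulVecLin) := by
    refine h.isControllable.cayley ?_ ?_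
    · refine LinearMap.ext fun v => ?_
      rw [mulVecLin_apply B, ← hN, ← mulVec_mulVec, sub_mulVec, one_mulVec]
      rfl
    · have hsurj := mulVec_surjective_iff_isUnit.mpr ((isUnit_iff_isUnit_det _).mpr hplus.isUnit)
      rw [Module.End.one_eq_id, ← mulVecLin_one, ← mulVecLin_add]
      exact hsurj
  obtain ⟨X, hsymm, hX, hdecr, hC⟩ := exists_lyapunov_of_suppliedEnergy_nonneg hctrl
    h.isObservable fun u T => mulVecLin_one_add_mul A N ▸ hF.suppliedEnergy_nonneg hA hN hminus u T
  refine ⟨hF.feedthrough_isSymm.symm, X, hsymm.symm, hX, hdecr, ?_⟩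
  rw [Matrix.mul_assoc, ← Matrix.neg_mul, neg_transpose_mul_inv_mul hN hminus, ← Matrix.mul_assoc]
  exact hC

end Necessity

section Sufficiency

section Contraction

variable {E : Type*} [AddCommGroup E] [Module ℝ E] {β : LinearMap.BilinForm ℝ E}
  {A : Module.End ℝ E} {x y : ℝ} {a b c : E}

theorem eq_zero_of_eigen_of_contraction (hβ : ∀ a, β a a ≤ 0 → a = 0)
    (hA : ∀ a, β (A a) (A a) ≤ β a a) (hxy : 1 < x ^ 2 + y ^ 2) (ha : A a = x • a - y • b)
    (hb : A b = x • b + y • a) : a = 0 ∧ b = 0 := by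
  have hβ0 : ∀ a, 0 ≤ β a a := fun a => by
    by_contra! h
    exact h.ne (by rw [hβ a h.le, map_zero])
  have hscale : β (A a) (A a) + β (A b) (A b) = (x ^ 2 + y ^ 2) * (β a a + β b b) := by
    rw [ha, hb]
    simp only [map_sub, map_add, map_smul, LinearMap.sub_apply, LinearMap.add_apply,
      LinearMap.smul_apply, smul_eq_mul]
    ring
  have hsum : β a a + β b b ≤ 0 := by nlinarith [hA a, hA b]
  exact ⟨hβ a (by linarith [hβ0 b]), hβ b (by linarith [hβ0 a])⟩

/-- The left side is a combination, with nonnegative coefficients, of the dissipation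
`β a a - β (A a) (A a)` of the states `b - A b`, `b + A b`, `b`, `A b` and of a value of `β`. -/
theorem bilin_nonneg_of_contraction (hβ : β.IsSymm) (hβ0 : ∀ a, 0 ≤ β a a)
    (hA : ∀ a, β (A a) (A a) ≤ β a a) (hxy : 1 ≤ x ^ 2 + y ^ 2) (b : E) :
    0 ≤ β (A (A b) - (2 * x) • A b + (x ^ 2 + y ^ 2) • b) (b - A (A b)) := by
  let d : E → ℝ := fun a => β a a - β (A a) (A a)
  have hd : ∀ a, 0 ≤ d a := fun a => sub_nonneg.mpr (hA a)
  have hcombination : β (A (A b) - (2 * x) • A b + (x ^ 2 + y ^ 2) • b) (b - A (A b)) =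
      (x + 1) ^ 2 / 4 * d (b - A b) + (x - 1) ^ 2 / 4 * d (b + A b) + y ^ 2 / 2 * (d b + d (A b)) +
        (x ^ 2 + y ^ 2 - 1) / 2 * β (b - A (A b)) (b - A (A b)) := by
    simp only [d, map_sub, map_add, map_smul, LinearMap.sub_apply, LinearMap.add_apply,
      LinearMap.smul_apply, smul_eq_mul, hβ.eq (A b) b, hβ.eq (A (A b)) b, hβ.eq (A (A b)) (A b)]
    ring
  rw [hcombination]
  have hρ : 0 ≤ (x ^ 2 + y ^ 2 - 1) / 2 := div_nonneg (sub_nonneg.mpr hxy) zero_le_two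
  have := mul_nonneg hρ (hβ0 (b - A (A b)))
  have := hd (b - A b)
  have := hd (b + A b)
  have := add_nonneg (hd b) (hd (A b))
  positivity

theorem mul_bilin_nonpos_of_contraction (hβ : β.IsSymm) (hβ0 : ∀ a, 0 ≤ β a a)
    (hA : ∀ a, β (A a) (A a) ≤ β a a) (hxy : 1 ≤ x ^ 2 + y ^ 2) (ha : A a = x • a - y • b - c)
    (hb : A b = x • b + y • a) : y * β c (b - A (A b)) ≤ 0 := by
  have hc : y • c = -(A (A b) - (2 * x) • A b + (x ^ 2 + y ^ 2) • b) := by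
    have hAA : A (A b) = x • A b + y • A a := by
      conv_lhs => rw [hb]
      rw [map_add, map_smul, map_smul]
    rw [hAA, ha, hb]
    module
  have h := bilin_nonneg_of_contraction hβ hβ0 hA hxy b
  rw [← smul_eq_mul, ← LinearMap.smul_apply, ← map_smul, hc, map_neg, LinearMap.neg_apply]
  exact neg_nonpos.mpr h

end Contraction

variable {n : Type*} [Fintype n]

theorem map_algebraMap_dotProduct {R S : Type*} [CommSemiring R] [Semiring S] [Algebra R S]
    (f : S →ₗ[R] R) (v : n → R) (w : n → S) : f ((algebraMap R S ∘ v) ⬝ᵥ w) = v ⬝ᵥ (f ∘ w) := by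
  simp only [dotProduct, Function.comp_apply, map_sum, ← Algebra.smul_def, map_smul, smul_eq_mul]

theorem comp_map_algebraMap_mulVec {R S m : Type*} [CommSemiring R] [Semiring S] [Algebra R S]
    (f : S →ₗ[R] R) (M : Matrix m n R) (w : n → S) :
    f ∘ (M.map (algebraMap R S) *ᵥ w) = M *ᵥ (f ∘ w) :=
  funext fun i => map_algebraMap_dotProduct f (M i) w

theorem re_im_resolvent_mulVec [DecidableEq n] {A : Matrix n n ℝ} {z : ℂ} {r : n → ℂ} {c : n → ℝ}
    (h : (z • (1 : Matrix n n ℂ) - A.map ι) *ᵥ r = ι ∘ c) :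
    A *ᵥ (Complex.re ∘ r) = z.re • (Complex.re ∘ r) - z.im • (Complex.im ∘ r) - c ∧
      A *ᵥ (Complex.im ∘ r) = z.re • (Complex.im ∘ r) + z.im • (Complex.re ∘ r) := by
  have hAr : A.map ι *ᵥ r = z • r - ι ∘ c := by
    rw [← h, sub_mulVec, smul_mulVec, one_mulVec, sub_sub_cancel]
  have hre : Complex.re ∘ (A.map ι *ᵥ r) = A *ᵥ (Complex.re ∘ r) :=
    comp_map_algebraMap_mulVec Complex.reLm A r
  have him : Complex.im ∘ (A.map ι *ᵥ r) = A *ᵥ (Complex.im ∘ r) :=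
    comp_map_algebraMap_mulVec Complex.imLm A r
  rw [← hre, ← him, hAr]
  refine ⟨funext fun i => ?_, funext fun i => ?_⟩
  · simp only [Function.comp_apply, Pi.sub_apply, Pi.smul_apply, smul_eq_mul, Complex.sub_re,
      Complex.mul_re, Complex.coe_algebraMap, Complex.ofReal_re]
  · simp only [Function.comp_apply, Pi.sub_apply, Pi.add_apply, Pi.smul_apply, smul_eq_mul,
      Complex.sub_im, Complex.mul_im, Complex.coe_algebraMap, Complex.ofReal_im, sub_zero]

theorem one_lt_re_sq_add_im_sq {z : ℂ} (hz : 1 < ‖z‖) : 1 < z.re ^ 2 + z.im ^ 2 := by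
  rw [sq, sq, ← Complex.normSq_apply, Complex.normSq_eq_norm_sq]
  exact one_lt_pow₀ hz two_ne_zero

theorem toBilin'_contraction_of_posSemidef [DecidableEq n] {A X : Matrix n n ℝ}
    (hXA : (X - Aᵀ * X * A).PosSemidef) (a : n → ℝ) :
    X.toBilin' (A.toLin' a) (A.toLin' a) ≤ X.toBilin' a a := by
  have h := hXA.dotProduct_mulVec_nonneg a
  rw [star_trivial, sub_mulVec, dotProduct_sub, sub_nonneg, ← toBilin'_apply', ← toBilin'_apply',
    ← toBilin'_comp] at h
  exact h

theorem det_resolvent_ne_zero_of_lyapunov [DecidableEq n] {A X : Matrix n n ℝ} (hX : X.PosDef)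
    (hXA : (X - Aᵀ * X * A).PosSemidef) {z : ℂ} (hz : 1 < ‖z‖) :
    (z • (1 : Matrix n n ℂ) - A.map ι).det ≠ 0 := by
  intro hdet
  obtain ⟨r, hr0, hr⟩ := exists_mulVec_eq_zero_iff.mpr hdet
  have hr' : (z • (1 : Matrix n n ℂ) - A.map ι) *ᵥ r = ι ∘ (0 : n → ℝ) :=
    hr.trans (funext fun _ => (map_zero ι).symm)
  obtain ⟨ha, hb⟩ := re_im_resolvent_mulVec hr'
  rw [sub_zero] at ha
  have hdef : ∀ a, X.toBilin' a a ≤ 0 → a = 0 := fun a h => by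
    by_contra ha
    exact h.not_gt (by simpa only [star_trivial, toBilin'_apply'] using hX.dotProduct_mulVec_pos ha)
  obtain ⟨hre, him⟩ := eq_zero_of_eigen_of_contraction (A := A.toLin') hdef
    (toBilin'_contraction_of_posSemidef hXA) (one_lt_re_sq_add_im_sq hz) ha hb
  exact hr0 (funext fun i => Complex.ext (congrFun hre i) (congrFun him i))

variable {m : Type*} [Fintype m]

theorem transferMatrix_mulVec_of_cayley {K : Type*} [Field K] [DecidableEq n] {A : Matrix n n K}
    {B N : Matrix n m K} {C : Matrix m n K} {D : Matrix m m K} {z : K} {r : n → K} {v : m → K}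
    (hN : (1 - A) * N = B) (hz : (z • (1 : Matrix n n K) - A).det ≠ 0)
    (hr : (z • (1 : Matrix n n K) - A) *ᵥ r = N *ᵥ v) :
    transferMatrix A B C D z *ᵥ v = C *ᵥ ((1 - A) *ᵥ r) + D *ᵥ v := by
  set R := z • (1 : Matrix n n K) - A with hR
  have hcomm : (1 - A) * R = R * (1 - A) :=
    ((Commute.one_right (1 - A)).smul_right z |>.sub_right
      ((Commute.one_left A).sub_left (Commute.refl A))).eq
  have hstate : R⁻¹ *ᵥ (B *ᵥ v) = (1 - A) *ᵥ r := by
    rw [← hN, ← mulVec_mulVec, ← hr, mulVec_mulVec _ (1 - A), hcomm, mulVec_mulVec,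
      nonsing_inv_mul_cancel_left _ _ hz.isUnit]
  rw [transferMatrix, ← hR, add_mulVec, ← mulVec_mulVec, ← mulVec_mulVec, hstate]

theorem im_dotProduct_transferMatrix_mulVec [DecidableEq n] {A X : Matrix n n ℝ}
    {B N : Matrix n m ℝ} (D : Matrix m m ℝ) {z : ℂ} {r : n → ℂ} {v : m → ℝ} (hN : (1 - A) * N = B)
    (hz : (z • (1 : Matrix n n ℂ) - A.map ι).det ≠ 0)
    (hr : (z • (1 : Matrix n n ℂ) - A.map ι) *ᵥ r = ι ∘ (N *ᵥ v)) :
    ((ι ∘ v) ⬝ᵥ transferMatrix (A.map ι) (B.map ι) ((Nᵀ * X * (A + 1)).map ι) (D.map ι) z *ᵥ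
        (ι ∘ v)).im =
      N *ᵥ v ⬝ᵥ X *ᵥ (Complex.im ∘ r - A *ᵥ (A *ᵥ (Complex.im ∘ r))) := by
  have hone : (1 - A).map ι = 1 - A.map ι := by
    rw [Matrix.map_sub ι (map_sub ι), Matrix.map_one ι (map_zero ι) (map_one ι)]
  have hN' : (1 - A.map ι) * N.map ι = B.map ι := by rw [← hone, ← Matrix.map_mul, hN]
  have hfactor : Nᵀ * X * (A + 1) * (1 - A) = Nᵀ * (X * (1 - A * A)) := by
    rw [Matrix.mul_assoc, Matrix.mul_assoc]
    noncomm_ring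
  have hvec : Complex.im ∘ r - A *ᵥ (A *ᵥ (Complex.im ∘ r)) = (1 - A * A) *ᵥ (Complex.im ∘ r) := by
    rw [sub_mulVec, one_mulVec, mulVec_mulVec]
  have hD : Complex.im ∘ (ι ∘ v) = 0 := funext fun i => Complex.ofReal_im (v i)
  have him : ∀ w : m → ℂ, ((ι ∘ v) ⬝ᵥ w).im = v ⬝ᵥ (Complex.im ∘ w) :=
    map_algebraMap_dotProduct Complex.imLm v
  have hCim : ∀ M : Matrix m n ℝ, Complex.im ∘ (M.map ι *ᵥ r) = M *ᵥ (Complex.im ∘ r) :=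
    fun M => comp_map_algebraMap_mulVec Complex.imLm M r
  have hDim : Complex.im ∘ (D.map ι *ᵥ (ι ∘ v)) = D *ᵥ (Complex.im ∘ ι ∘ v) :=
    comp_map_algebraMap_mulVec Complex.imLm D (ι ∘ v)
  rw [comp_mulVec] at hr
  rw [transferMatrix_mulVec_of_cayley hN' hz hr, ← hone, mulVec_mulVec, ← Matrix.map_mul,
    dotProduct_add, Complex.add_im, him, him, hfactor, hCim, hDim, hD, mulVec_zero,
    dotProduct_zero, add_zero, ← mulVec_mulVec, ← mulVec_mulVec, hvec, dotProduct_mulVec,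
    vecMul_transpose]

theorem im_mul_im_transferMatrix_nonpos [DecidableEq n] {A X : Matrix n n ℝ} {B N : Matrix n m ℝ}
    (D : Matrix m m ℝ) (hX : X.PosDef) (hXA : (X - Aᵀ * X * A).PosSemidef) (hN : (1 - A) * N = B)
    {z : ℂ} (hz : 1 < ‖z‖) (v : m → ℝ) :
    z.im * ((ι ∘ v) ⬝ᵥ transferMatrix (A.map ι) (B.map ι) ((Nᵀ * X * (A + 1)).map ι) (D.map ι) z *ᵥ
      (ι ∘ v)).im ≤ 0 := by
  have hdet := det_resolvent_ne_zero_of_lyapunov hX hXA hz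
  set R := z • (1 : Matrix n n ℂ) - A.map ι
  have hr : R *ᵥ (R⁻¹ *ᵥ (ι ∘ (N *ᵥ v))) = ι ∘ (N *ᵥ v) := by
    rw [mulVec_mulVec, mul_nonsing_inv _ hdet.isUnit, one_mulVec]
  obtain ⟨ha, hb⟩ := re_im_resolvent_mulVec hr
  have hsymm : X.toBilin'.IsSymm := isSymm_toBilin'_iff_isSymm.mpr
    ((conjTranspose_eq_transpose_of_trivial X).symm.trans hX.isHermitian)
  have hnonneg : ∀ a, 0 ≤ X.toBilin' a a := fun a => by
    simpa only [star_trivial, toBilin'_apply'] using hX.posSemidef.dotProduct_mulVec_nonneg a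
  have h := mul_bilin_nonpos_of_contraction (A := A.toLin') hsymm hnonneg
    (toBilin'_contraction_of_posSemidef hXA) (one_lt_re_sq_add_im_sq hz).le ha hb
  rw [im_dotProduct_transferMatrix_mulVec D hN hdet hr, ← toBilin'_apply']
  exact h

theorem star_dotProduct_mulVec_of_isSymm {M : Matrix m m ℂ} (hM : M.IsSymm) (v : m → ℂ) :
    star v ⬝ᵥ M *ᵥ v =
      (ι ∘ Complex.re ∘ v) ⬝ᵥ M *ᵥ (ι ∘ Complex.re ∘ v) +
        (ι ∘ Complex.im ∘ v) ⬝ᵥ M *ᵥ (ι ∘ Complex.im ∘ v) := by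
  set a := ι ∘ Complex.re ∘ v
  set b := ι ∘ Complex.im ∘ v
  have hv : v = a + Complex.I • b := funext fun i => by
    simp only [a, b, Function.comp_apply, Complex.coe_algebraMap, Pi.add_apply, Pi.smul_apply,
      smul_eq_mul, mul_comm Complex.I, Complex.re_add_im]
  have hstar : star v = a - Complex.I • b := funext fun i => by
    simp [a, b, Complex.ext_iff]
  have hswap : b ⬝ᵥ M *ᵥ a = a ⬝ᵥ M *ᵥ b := by
    rw [dotProduct_mulVec, dotProduct_comm, ← mulVec_transpose, hM.eq]
  rw [hstar]
  conv_lhs => rw [hv]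
  simp only [mulVec_add, mulVec_smul, dotProduct_add, sub_dotProduct, smul_dotProduct,
    dotProduct_smul, smul_eq_mul, hswap]
  linear_combination -(b ⬝ᵥ M *ᵥ b) * Complex.I_mul_I

theorem IsDiscreteNegImag.of_im_mul_im_nonpos {m : ℕ} {F : ℂ → Matrix (Fin m) (Fin m) ℂ}
    (hanalytic : ∀ i j, AnalyticOnNhd ℂ (fun z => F z i j) {z : ℂ | 1 < ‖z‖})
    (hreal : ∀ z : ℂ, 1 < ‖z‖ → z.im = 0 → (F z).IsHermitian)
    (him : ∀ z : ℂ, 1 < ‖z‖ → ∀ v, z.im * (star v ⬝ᵥ F z *ᵥ v).im ≤ 0) :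
    IsDiscreteNegImag F := by
  have hherm : ∀ z, (Complex.I • (F z - (F z)ᴴ)).IsHermitian := fun z => by
    rw [IsHermitian, conjTranspose_smul, conjTranspose_sub, conjTranspose_conjTranspose,
      Complex.star_def, Complex.conj_I, neg_smul, ← smul_neg, neg_sub]
  refine ⟨hanalytic, fun z hz hpos => ?_, fun z hz h0 => ?_, fun z hz hneg => ?_⟩
  · refine .of_dotProduct_mulVec_nonneg (hherm z) fun v => ?_
    rw [star_dotProduct_I_smul_sub_conjTranspose_mulVec, Complex.zero_le_real]
    linarith [nonpos_of_mul_nonpos_right (him z hz v) hpos]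
  · rw [(hreal z hz h0).eq, sub_self, smul_zero]
  · refine .of_dotProduct_mulVec_nonneg (hherm z).neg fun v => ?_
    rw [neg_mulVec, dotProduct_neg, star_dotProduct_I_smul_sub_conjTranspose_mulVec,
      ← Complex.ofReal_neg, Complex.zero_le_real]
    linarith [nonneg_of_mul_nonpos_right (him z hz v) hneg]

theorem IsRealization.isDiscreteNegImag {m n : ℕ} {G : Matrix (Fin m) (Fin m) (RatFunc ℝ)}
    {A : Matrix (Fin n) (Fin n) ℝ} {B : Matrix (Fin n) (Fin m) ℝ} {C : Matrix (Fin m) (Fin n) ℝ}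
    {D : Matrix (Fin m) (Fin m) ℝ} (h : IsRealization G A B C D) (hminus : (1 - A).det ≠ 0)
    (hG : G = Gᵀ) (hABCD : NegImagStateSpaceCondition A B C D) :
    IsDiscreteNegImag (transferEval G) := by
  obtain ⟨-, X, -, hX, hXA, hC⟩ := hABCD
  have hN : (1 - A) * ((1 - A)⁻¹ * B) = B := mul_nonsing_inv_cancel_left _ _ hminus.isUnit
  set N := (1 - A)⁻¹ * B
  have hC' : C = Nᵀ * X * (A + 1) := by
    rw [hC, ← neg_transpose_mul_inv_mul hN hminus, Matrix.neg_mul, Matrix.neg_mul]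
  have hdet : ∀ z : ℂ, 1 < ‖z‖ → (z • (1 : Matrix (Fin n) (Fin n) ℂ) - A.map ι).det ≠ 0 :=
    fun z => det_resolvent_ne_zero_of_lyapunov hX hXA
  have hsymm : ∀ z, (transferEval G z).IsSymm := fun z => by
    rw [IsSymm, transferEval, ← transpose_map, ← hG]
  refine .of_im_mul_im_nonpos
    (fun i j z hz => h.analyticAt_transferEval (hdet z hz) i j) (fun z hz hz0 => ?_)
    fun z hz v => ?_
  · obtain ⟨x, rfl⟩ : ∃ x : ℝ, ι x = z := ⟨z.re, Complex.ext rfl hz0.symm⟩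
    have hmap : transferEval G (ι x) = (transferMatrix A B C D x).map ι := by
      rw [h.transferEval_eq (hdet _ hz), map_transferMatrix]
    rw [IsHermitian, conjTranspose, hsymm, hmap]
    exact Matrix.ext fun i j => Complex.conj_ofReal _
  · have hreal : ∀ w : Fin m → ℝ, z.im * ((ι ∘ w) ⬝ᵥ transferEval G z *ᵥ (ι ∘ w)).im ≤ 0 := by
      rw [h.transferEval_eq (hdet z hz), hC']
      exact im_mul_im_transferMatrix_nonpos D hX hXA hN hz
    rw [star_dotProduct_mulVec_of_isSymm (hsymm z), Complex.add_im, mul_add]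
    exact add_nonpos (hreal _) (hreal _)

end Sufficiency

theorem mainTheorem3 {m n : ℕ} (G : Matrix (Fin m) (Fin m) (RatFunc ℝ))
    (A : Matrix (Fin n) (Fin n) ℝ) (B : Matrix (Fin n) (Fin m) ℝ)
    (C : Matrix (Fin m) (Fin n) ℝ) (D : Matrix (Fin m) (Fin m) ℝ)
    (hproper : IsProperTransfer G)
    (hmin : IsMinimalRealization G A B C D)
    (hplus : (1 + A).det ≠ 0) (hminus : (1 - A).det ≠ 0) :
    (IsDiscreteNegImag (transferEval G) → NegImagStateSpaceCondition A B C D) ∧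
      (G = G.transpose →
        (IsDiscreteNegImag (transferEval G) ↔ NegImagStateSpaceCondition A B C D)) := by
  have hnec := hmin.negImagStateSpaceCondition hplus hminus
  exact ⟨hnec, fun hG => ⟨hnec, hmin.1.isDiscreteNegImag hminus hG⟩⟩
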